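/- Let $k$ be an algebraic extension of $\mathbb{Q}$ (for instance a number field, or $\overline{\mathbb{Q}}$), and let $V$ be a projective variety over $k$, i.e. an integral closed subscheme of some $\mathbb{P}^N_k$. Divisors on $V$ are Cartier divisors. A divisor $D$ is very ample if $D\sim i^*H$ for some closed embedding $i:V\to\mathbb{P}^n_k$ over $k$ and some hyperplane $H\subset\mathbb{P}^n_k$ not containing $i(V)$, and $D$ is ample if $mD$ is very ample for some integer $m>0$. A Weil height function corresponding to a divisor $D$ is a function $h_D:V(\overline{k})\to\mathbb{R}$ such that, for some $k$-morphisms $\varphi:V\to\mathbb{P}^n_k$, $\psi:V\to\mathbb{P}^m_k$ and hyperplanes $H\not\supset\varphi(V)$, $H'\not\supset\psi(V)$ with $D\sim\varphi^*H-\psi^*H'$, one has $h_D(P)=h(\varphi(P))-h(\psi(P))+O(1)$ for all $P\in V(\overline{k})$, where $h$ is the absolute logarithmic height on projective space. (1) Let $D_1,D_2$ be ample divisors on $V$ and let $h_{D_1},h_{D_2}$ be corresponding Weil height functions. Then \[ 0<\liminf_{h_{D_2}(P)\to\infty}\frac{h_{D_1}(P)}{h_{D_2}(P)},\qquad \limsup_{h_{D_2}(P)\to\infty}\frac{h_{D_1}(P)}{h_{D_2}(P)}<\infty,\qquad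 \limsup_{h_{D_2}(P)\to\infty}\left|\frac{h_{D_1}(P)}{h_{D_2}(P)}\right|<\infty . \] (2) Let $D$ be an ample divisor and $E$ an arbitrary divisor on $V$, and let $h_D,h_E$ be corresponding Weil height functions. Then \[ \limsup_{h_D(P)\to\infty}\left|\frac{h_E(P)}{h_D(P)}\right|<\infty . \] Here $P$ runs over $V(\overline{k})$, and the upper and lower limits are taken in $[-\infty,\infty]$ along the sets $\{P: h_{D_2}(P)\ge M\}$ (respectively $\{P : h_D(P)\ge M\}$), $M\to\infty$; if these sets are eventually empty, the liminf is $+\infty$ and the limsup is $-\infty$. -/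

import Mathlib

open AlgebraicGeometry CategoryTheory

universe u

noncomputable section

namespace HeightRatio

/-! ### Projective space over a field and its standard charts -/

/-- The grading of `k[X₀, …, Xₙ]` by degree. -/
abbrev grading (k : Type u) [Field k] (n : ℕ) :
    ℕ → Submodule k (MvPolynomial (Fin (n + 1)) k) :=
  MvPolynomial.homogeneousSubmodule (Fin (n + 1)) k

instance gradedAlgebra_grading (k : Type u) [Field k] (n : ℕ) : GradedAlgebra (grading k n) :=
  MvPolynomial.gradedAlgebra

/-- Projective space `ℙⁿ_k = Proj k[X₀, …, Xₙ]`. -/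
abbrev ProjSpace (k : Type u) [Field k] (n : ℕ) : Scheme.{u} :=
  Proj (grading k n)

/-- The structure morphism `ℙⁿ_k ⟶ Spec k`. -/
def ProjSpace.toSpec (k : Type u) [Field k] (n : ℕ) : ProjSpace k n ⟶ Spec (.of k) :=
  Proj.toSpecZero (grading k n) ≫
    Spec.map (CommRingCat.ofHom (algebraMap k (grading k n 0)))

/-- The standard chart `D₊(Xⱼ)`. -/
abbrev chart (k : Type u) [Field k] (n : ℕ) (j : Fin (n + 1)) : (ProjSpace k n).Opens :=
  Proj.basicOpen (grading k n) (MvPolynomial.X j)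

lemma X_mem_grading (k : Type u) [Field k] (n : ℕ) (j : Fin (n + 1)) :
    (MvPolynomial.X j : MvPolynomial (Fin (n + 1)) k) ∈ grading k n 1 :=
  (MvPolynomial.mem_homogeneousSubmodule _ _).2 (MvPolynomial.isHomogeneous_X k j)

/-- For a linear form `ℓ`, the regular function `ℓ / Xⱼ` on the chart `D₊(Xⱼ)`. -/
def ratio {k : Type u} [Field k] {n : ℕ} (ℓ : grading k n 1) (j : Fin (n + 1)) :
    Γ(ProjSpace k n, chart k n j) :=
  Proj.awayToSection (grading k n) (MvPolynomial.X j)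
    (HomogeneousLocalization.Away.mk (grading k n) (X_mem_grading k n j) 1 ℓ.1
      (by simp))

/-- The `l`-th homogeneous coordinate as a linear form. -/
def coordForm (k : Type u) [Field k] (n : ℕ) (l : Fin (n + 1)) : grading k n 1 :=
  ⟨MvPolynomial.X l, X_mem_grading k n l⟩

lemma iSup_chart (k : Type u) [Field k] (n : ℕ) : ⨆ j, chart k n j = ⊤ := by
  refine Proj.iSup_basicOpen_eq_top' (grading k n) _ (fun j => ⟨1, X_mem_grading k n j⟩) ?_
  refine top_le_iff.1 fun p _ => ?_
  induction p using MvPolynomial.induction_on with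
  | C a =>
    exact Subalgebra.algebraMap_mem _
      (⟨MvPolynomial.C a, (MvPolynomial.mem_homogeneousSubmodule _ _).2
        (MvPolynomial.isHomogeneous_C _ a)⟩ : grading k n 0)
  | add p q hp hq => exact add_mem (hp trivial) (hq trivial)
  | mul_X p i hp => exact mul_mem (hp trivial) (Algebra.subset_adjoin ⟨i, rfl⟩)

/-! ### Absolute logarithmic height -/

open Classical in
/-- The absolute logarithmic height of the point of projective space with homogeneous coordinates
`x`: if `L = ℚ(x₀, …, xₙ)` is the number field generated by the coordinates, this is
`[L : ℚ]⁻¹ ∑_w n_w log maxᵢ |xᵢ|_w`, the sum being over the places of `L`.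
(The value is `0` if the coordinates are not all algebraic over `ℚ`.) -/
def absLogHeight {ι : Type*} {K : Type*} [Field K] [CharZero K] (x : ι → K) : ℝ :=
  if hx : FiniteDimensional ℚ (IntermediateField.adjoin ℚ (Set.range x)) then
    haveI : NumberField (IntermediateField.adjoin ℚ (Set.range x)) := { to_finiteDimensional := hx }
    (Module.finrank ℚ (IntermediateField.adjoin ℚ (Set.range x)) : ℝ)⁻¹ *
      Height.logHeight (K := IntermediateField.adjoin ℚ (Set.range x))
        (fun i => ⟨x i, IntermediateField.subset_adjoin ℚ _ ⟨i, rfl⟩⟩)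
  else 0

/-! ### Points with values in a field, and their homogeneous coordinates -/

/-- The value in `L` of a section over an open set containing the image of an `L`-point. -/
def evalAt {X : Scheme.{u}} {L : Type u} [Field L] (p : Spec (.of L) ⟶ X) (U : X.Opens)
    (hU : ⊤ ≤ p ⁻¹ᵁ U) (s : Γ(X, U)) : L :=
  (Scheme.ΓSpecIso (.of L)).hom (p.appLE U ⊤ hU s)

lemma exists_chart {k L : Type u} [Field k] [Field L] {n : ℕ}
    (p : Spec (.of L) ⟶ ProjSpace k n) : ∃ j, ⊤ ≤ p ⁻¹ᵁ chart k n j := by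
  let x : Spec (.of L) := (⊥ : PrimeSpectrum L)
  have hx : p x ∈ ⨆ j, chart k n j := by rw [iSup_chart]; trivial
  obtain ⟨j, hj⟩ := TopologicalSpace.Opens.mem_iSup.1 hx
  refine ⟨j, fun y _ => ?_⟩
  have : y = x := Subsingleton.elim (α := PrimeSpectrum L) y x
  rw [this]
  exact hj

/-- Homogeneous coordinates of an `L`-point of `ℙⁿ_k`, normalized so that one of them is `1`. -/
def homCoords {k L : Type u} [Field k] [Field L] {n : ℕ}
    (p : Spec (.of L) ⟶ ProjSpace k n) : Fin (n + 1) → L := fun l =>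
  evalAt p (chart k n (exists_chart p).choose) (exists_chart p).choose_spec
    (ratio (coordForm k n l) (exists_chart p).choose)

/-- The set `V(k̄)` of geometric points of a `k`-scheme `π : V ⟶ Spec k`. -/
def GeomPoint {k : Type u} [Field k] {V : Scheme.{u}} (π : V ⟶ Spec (.of k)) : Type u :=
  {P : Spec (.of (AlgebraicClosure k)) ⟶ V //
    P ≫ π = Spec.map (CommRingCat.ofHom (algebraMap k (AlgebraicClosure k)))}

/-- The function `P ↦ h(φ(P))` on `V(k̄)`, for `φ : V ⟶ ℙⁿ` and `h` the absolute logarithmic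
height on `ℙⁿ(k̄)`. -/
def mapHeight {k : Type u} [Field k] [CharZero k] {V : Scheme.{u}} {π : V ⟶ Spec (.of k)} {n : ℕ}
    (φ : V ⟶ ProjSpace k n) (P : GeomPoint π) : ℝ :=
  haveI : CharZero (AlgebraicClosure k) := charZero_of_injective_algebraMap
    (algebraMap k (AlgebraicClosure k)).injective
  absLogHeight (homCoords (P.1 ≫ φ))

/-! ### Cartier divisors on an integral scheme -/

section Divisors

variable (V : Scheme.{u}) [IsIntegral V]

/-- The subgroup `𝒪_{V,x}ˣ` of `K(V)ˣ`. -/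
def unitsAt (x : V) : Subgroup V.functionFieldˣ :=
  (Units.map (algebraMap (V.presheaf.stalk x) V.functionField).toMonoidHom).range

/-- The group of global sections of `K(V)ˣ / 𝒪_Vˣ`, written multiplicatively: families of classes
in `K(V)ˣ / 𝒪_{V,x}ˣ` which locally come from a single rational function. -/
def cartierSubgroup : Subgroup ((x : V) → V.functionFieldˣ ⧸ unitsAt V x) where
  carrier := {D | ∀ x : V, ∃ U : V.Opens, x ∈ U ∧ ∃ f : V.functionFieldˣ,
    ∀ y ∈ U, D y = QuotientGroup.mk f}
  one_mem' _ := ⟨⊤, trivial, 1, fun _ _ => rfl⟩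
  mul_mem' {D E} hD hE x := by
    obtain ⟨U, hxU, f, hf⟩ := hD x
    obtain ⟨W, hxW, g, hg⟩ := hE x
    exact ⟨U ⊓ W, ⟨hxU, hxW⟩, f * g, fun y hy => by
      rw [Pi.mul_apply, hf y hy.1, hg y hy.2]; rfl⟩
  inv_mem' {D} hD x := by
    obtain ⟨U, hxU, f, hf⟩ := hD x
    exact ⟨U, hxU, f⁻¹, fun y hy => by rw [Pi.inv_apply, hf y hy]; rfl⟩

/-- The additive group of (Cartier) divisors on `V`. -/
abbrev Divisor : Type u := Additive (cartierSubgroup V)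

variable {V}

/-- `f` is a local equation of `D` at `x`. -/
def Divisor.IsLocalEquation (D : Divisor V) (x : V) (f : V.functionFieldˣ) : Prop :=
  D.toMul.1 x = QuotientGroup.mk f

/-- The principal divisor `div f`. -/
def Divisor.principal (f : V.functionFieldˣ) : Divisor V :=
  Additive.ofMul ⟨fun _ => QuotientGroup.mk f, fun _ => ⟨⊤, trivial, f, fun _ _ => rfl⟩⟩

/-- Linear equivalence of divisors. -/
def Divisor.LinEquiv (D E : Divisor V) : Prop :=
  ∃ f : V.functionFieldˣ, D - E = Divisor.principal f

/-- `D = φ^*H`, where `H` is the hyperplane `ℓ = 0`: wherever `φ` maps to the chart `D₊(Xⱼ)`, the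
divisor `D` has local equation `φ^*(ℓ / Xⱼ)`, which has to be a nonzero rational function
(that is, `φ(V)` is not contained in `H`). -/
def IsHyperplanePullback {k : Type u} [Field k] {n : ℕ} (φ : V ⟶ ProjSpace k n)
    (ℓ : grading k n 1) (D : Divisor V) : Prop :=
  ∀ (j : Fin (n + 1)) (x : V) (hx : x ∈ φ ⁻¹ᵁ chart k n j),
    ∃ f : V.functionFieldˣ,
      (f : V.functionField) = algebraMap (V.presheaf.stalk x) V.functionField
        (V.presheaf.germ (φ ⁻¹ᵁ chart k n j) x hx (φ.app (chart k n j) (ratio ℓ j))) ∧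
      D.IsLocalEquation x f

/-- `D` is linearly equivalent to `φ^*H` for a hyperplane `H`. -/
def IsHyperplaneClass {k : Type u} [Field k] {n : ℕ} (φ : V ⟶ ProjSpace k n)
    (D : Divisor V) : Prop :=
  ∃ (ℓ : grading k n 1) (A : Divisor V), IsHyperplanePullback φ ℓ A ∧ D.LinEquiv A

end Divisors

/-! ### Projectivity, ampleness and Weil heights -/

section Heights

variable {k : Type u} [Field k] {V : Scheme.{u}}

/-- `V` is projective over `k`: it is a closed subscheme of some `ℙⁿ_k`. -/
def IsProjective (π : V ⟶ Spec (.of k)) : Prop :=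
  ∃ (n : ℕ) (φ : V ⟶ ProjSpace k n), φ ≫ ProjSpace.toSpec k n = π ∧ IsClosedImmersion φ

variable [IsIntegral V]

/-- `D` is very ample: it is a hyperplane section, up to linear equivalence, for some closed
embedding of `V` in a projective space. -/
def IsVeryAmple (π : V ⟶ Spec (.of k)) (D : Divisor V) : Prop :=
  ∃ (n : ℕ) (φ : V ⟶ ProjSpace k n), φ ≫ ProjSpace.toSpec k n = π ∧ IsClosedImmersion φ ∧
    IsHyperplaneClass φ D

/-- `D` is ample: some positive multiple is very ample. -/
def IsAmple (π : V ⟶ Spec (.of k)) (D : Divisor V) : Prop :=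
  ∃ m : ℕ, 0 < m ∧ IsVeryAmple π (m • D)

/-- `h` is a Weil height function on `V(k̄)` corresponding to `D`: writing `D ∼ A - B` with
`A`, `B` the hyperplane classes of morphisms `φ : V ⟶ ℙⁿ`, `ψ : V ⟶ ℙᵐ` over `k`, one has
`h = h ∘ φ - h ∘ ψ + O(1)`. -/
def IsWeilHeight [CharZero k] (π : V ⟶ Spec (.of k)) (D : Divisor V)
    (h : GeomPoint π → ℝ) : Prop :=
  ∃ (n m : ℕ) (φ : V ⟶ ProjSpace k n) (ψ : V ⟶ ProjSpace k m) (A B : Divisor V),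
    φ ≫ ProjSpace.toSpec k n = π ∧ ψ ≫ ProjSpace.toSpec k m = π ∧
    IsHyperplaneClass φ A ∧ IsHyperplaneClass ψ B ∧ D.LinEquiv (A - B) ∧
    ∃ C : ℝ, ∀ P : GeomPoint π, |h P - (mapHeight φ P - mapHeight ψ P)| ≤ C

end Heights

end HeightRatio

end

open HeightRatio Filter

/-!
A tuple `f` of rational functions determines a map to projective space. It is defined at a point of
`V` exactly when one entry of `f` dominates the others over the local ring there, and evaluating
the quotients by that entry gives the height of the image. All heights of points of `V` are computed
in this way, so they are compared by identities between rational functions.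

Suppose that `s` and `t` are tuples defining the same divisor class, and that `t` is an embedding.
The quotients `tₗ / sⱼ` are regular on the affine charts of the embedding given by the products
`sᵢ tₐ`, hence they become forms of degree `M` in these products after multiplication by
`(sⱼ tₗ) ^ M`, for large `M`. A form of degree `M` raises heights by a factor of at most `M`, up to
a bounded term, and comparing degrees gives `h(t) ≤ h(s) + O(1)`. If `D ∼ A - B` with `A`, `B` the
hyperplane classes of `φ`, `ψ`, and `m D` is that of a closed embedding `i`, then `m A ∼ m B + m D`,
where the right-hand side is the class of the product of the `m`-th power of `ψ` with `i`, again an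
embedding. So `m h(ψ(P)) + h(i(P)) ≤ m h(φ(P)) + O(1)`, that is, `h(i(P)) ≤ m h_D(P) + O(1)`.

On the other hand the height of every morphism, and so every Weil height, is bounded by an affine
function of `h(i(P))`: locally on the image of `i` the morphism is given by forms. Hence
`|h_E| ≤ a h_D + b` for `D` ample and `E` arbitrary.
-/

noncomputable section

namespace HeightRatio

/-! ### Heights under extension of number fields -/

section Extension

open NumberField Height Module

lemma prod_infinitePlace_iSup_eq_prod_embeddings {K ι : Type*} [Field K] [NumberField K]
    (x : ι → K) :
    ∏ v : InfinitePlace K, (⨆ i, v (x i)) ^ v.mult = ∏ σ : K →+* ℂ, ⨆ i, ‖σ (x i)‖ := by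
  classical
  rw [← Finset.prod_fiberwise Finset.univ InfinitePlace.mk (fun σ : K →+* ℂ => ⨆ i, ‖σ (x i)‖)]
  refine Finset.prod_congr rfl fun w _ => ?_
  have (σ) (hσ : σ ∈ ({σ | InfinitePlace.mk σ = w} : Finset (K →+* ℂ))) :
      ⨆ i, ‖σ (x i)‖ = ⨆ i, w (x i) := by
    simp_rw [← (Finset.mem_filter.mp hσ).2, InfinitePlace.apply]
  rw [Finset.prod_congr rfl this, Finset.prod_const, InfinitePlace.card_filter_mk_eq]

variable {K L : Type*} [Field K] [NumberField K] [Field L] [NumberField L] [Algebra K L]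

lemma card_embeddings_extending (σ : K →+* ℂ) [DecidableEq (K →+* ℂ)] :
    (Finset.univ.filter fun τ : L →+* ℂ => τ.comp (algebraMap K L) = σ).card = finrank K L := by
  let := σ.toAlgebra
  have : FiniteDimensional K L := FiniteDimensional.right ℚ K L
  rw [← AlgHom.card K L ℂ, ← Fintype.card_subtype]
  refine Fintype.card_congr
    { toFun := fun τ => { τ.1 with commutes' := fun r => RingHom.congr_fun τ.2 r }
      invFun := fun τ => ⟨τ, RingHom.ext fun r => τ.commutes r⟩
      left_inv := fun τ => rfl
      right_inv := fun τ => rfl }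

lemma prod_embeddings_algebraMap {ι : Type*} (x : ι → K) :
    ∏ τ : L →+* ℂ, ⨆ i, ‖τ (algebraMap K L (x i))‖ =
      (∏ σ : K →+* ℂ, ⨆ i, ‖σ (x i)‖) ^ finrank K L := by
  classical
  rw [← Finset.prod_fiberwise Finset.univ (fun τ : L →+* ℂ => τ.comp (algebraMap K L)),
    ← Finset.prod_pow]
  refine Finset.prod_congr rfl fun σ _ => ?_
  have (τ) (hτ : τ ∈ ({τ | τ.comp (algebraMap K L) = σ} : Finset (L →+* ℂ))) :
      ⨆ i, ‖τ (algebraMap K L (x i))‖ = ⨆ i, ‖σ (x i)‖ := by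
    simp_rw [← (Finset.mem_filter.mp hτ).2, RingHom.comp_apply]
  rw [Finset.prod_congr rfl this, Finset.prod_const]
  congr 1
  convert card_embeddings_extending (L := L) σ

lemma finprod_finitePlace_algebraMap {ι : Type*} [Finite ι] {x : ι → 𝓞 K} (hx : x ≠ 0) :
    ∏ᶠ v : FinitePlace L, ⨆ i, v (algebraMap K L (x i)) =
      (∏ᶠ v : FinitePlace K, ⨆ i, v (x i)) ^ finrank K L := by
  have hx' : (fun i => algebraMap (𝓞 K) (𝓞 L) (x i)) ≠ 0 := by
    obtain ⟨i, hi⟩ := Function.ne_iff.1 hx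
    exact Function.ne_iff.2 ⟨i, by simpa using hi⟩
  have hK := absNorm_mul_finprod_finitePlace_eq_one hx
  have hL := absNorm_mul_finprod_finitePlace_eq_one hx'
  have hspan : Ideal.span (Set.range fun i => algebraMap (𝓞 K) (𝓞 L) (x i)) =
      Ideal.map (algebraMap (𝓞 K) (𝓞 L)) (Ideal.span (Set.range x)) := by
    rw [Ideal.map_span, ← Set.range_comp]; rfl
  rw [hspan, Ideal.absNorm_algebraMap, ← IsFractionRing.finrank_eq (𝓞 K) K (𝓞 L) L] at hL
  have hcoe (i : ι) : ((algebraMap (𝓞 K) (𝓞 L) (x i) : 𝓞 L) : L) = algebraMap K L (x i) := rfl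
  simp only [hcoe] at hL
  have h0 : ((Ideal.absNorm (Ideal.span (Set.range x)) : ℕ) : ℝ) ^ finrank K L ≠ 0 :=
    pow_ne_zero _ (left_ne_zero_of_mul (hK.trans_ne one_ne_zero))
  refine mul_left_cancel₀ h0 ?_
  rw [← mul_pow, hK, one_pow]
  exact_mod_cast hL

lemma mulHeight_algebraMap {ι : Type*} [Finite ι] (x : ι → K) :
    mulHeight (fun i => algebraMap K L (x i)) = mulHeight x ^ finrank K L := by
  rcases eq_or_ne x 0 with rfl | hx
  · have : (fun i => algebraMap K L ((0 : ι → K) i)) = 0 := by ext; simp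
    rw [this, mulHeight_zero, mulHeight_zero, one_pow]
  obtain ⟨b, hb⟩ := IsLocalization.exist_integer_multiples_of_finite (nonZeroDivisors (𝓞 K)) x
  choose y hy using hb
  have hb0 : algebraMap (𝓞 K) K b ≠ 0 := by
    simp
  have hyx : (fun i => (y i : K)) = algebraMap (𝓞 K) K b • x := by
    ext i; rw [Pi.smul_apply, smul_eq_mul, ← Algebra.smul_def]; exact hy i
  have hyx' : (fun i => algebraMap K L (y i)) =
      algebraMap K L (algebraMap (𝓞 K) K b) • fun i => algebraMap K L (x i) := by
    ext i
    rw [congrFun hyx i]; simp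
  have hy1 : (fun i => (y i : K)) ≠ 0 := by
    rw [hyx]; exact smul_ne_zero hb0 hx
  have hy0 : y ≠ 0 := by rintro rfl; exact hy1 (by ext; simp)
  have hy2 : (fun i => algebraMap K L (y i)) ≠ 0 := by
    obtain ⟨i, hi⟩ := Function.ne_iff.1 hy1
    exact Function.ne_iff.2 ⟨i, by simpa using hi⟩
  rw [← mulHeight_smul_eq_mulHeight x hb0, ← hyx,
    ← mulHeight_smul_eq_mulHeight _ ((map_ne_zero (algebraMap K L)).2 hb0), ← hyx',
    NumberField.mulHeight_eq hy1, NumberField.mulHeight_eq hy2, finprod_finitePlace_algebraMap hy0,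
    prod_infinitePlace_iSup_eq_prod_embeddings, prod_infinitePlace_iSup_eq_prod_embeddings,
    prod_embeddings_algebraMap, mul_pow]

lemma logHeight_algebraMap {ι : Type*} [Finite ι] (x : ι → K) :
    logHeight (fun i => algebraMap K L (x i)) = finrank K L * logHeight x := by
  rw [logHeight_eq_log_mulHeight, logHeight_eq_log_mulHeight, mulHeight_algebraMap, Real.log_pow]

end Extension

/-! ### The absolute height and polynomial maps -/

section AbsoluteHeight

open Height Module

variable {ι ι' : Type*}

/-- The coordinates of the Segre product of the maps with coordinates `x` and `y`. -/
def segre {R : Type*} [Mul R] (x : ι → R) (y : ι' → R) : ι × ι' → R :=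
  fun p => x p.1 * y p.2

lemma segre_ne_zero {R : Type*} [MulZeroClass R] [NoZeroDivisors R] {x : ι → R} {y : ι' → R}
    (hx : x ≠ 0) (hy : y ≠ 0) : segre x y ≠ 0 := by
  obtain ⟨i, hi⟩ := Function.ne_iff.1 hx
  obtain ⟨j, hj⟩ := Function.ne_iff.1 hy
  exact Function.ne_iff.2 ⟨(i, j), mul_ne_zero hi hj⟩

lemma map_segre {R S : Type*} [Mul R] [Mul S] {F : Type*} [FunLike F R S] [MulHomClass F R S]
    (f : F) (x : ι → R) (y : ι' → R) :
    (fun p => f (segre x y p)) = segre (fun i => f (x i)) fun j => f (y j) :=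
  funext fun _ => map_mul f _ _

/-- Products over all `n`-tuples of coordinates: the `n`-th tensor power of `x`. -/
def tensorPow {R : Type*} [CommMonoid R] (x : ι → R) (n : ℕ) : (Fin n → ι) → R :=
  fun s => ∏ i, x (s i)

lemma tensorPow_smul {R : Type*} [CommMonoid R] (c : R) (x : ι → R) (n : ℕ) :
    tensorPow (c • x) n = c ^ n • tensorPow x n := by
  ext s
  simp [tensorPow, Finset.prod_mul_distrib]

/-- The map given by forms of degree `n`, where `A (j, s)` is the coefficient in the `j`-th form of
the monomial `∏ i, X (s i)`. -/
def formMap {k R : Type*} [CommRing k] [CommRing R] [Algebra k R] [Fintype ι] {n : ℕ}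
    (A : ι' × (Fin n → ι) → k) (x : ι → R) (j : ι') : R :=
  ∑ s, A (j, s) • tensorPow x n s

lemma formMap_smul {k R : Type*} [CommRing k] [CommRing R] [Algebra k R] [Fintype ι] {n : ℕ}
    (A : ι' × (Fin n → ι) → k) (c : R) (x : ι → R) (j : ι') :
    formMap A (c • x) j = c ^ n * formMap A x j := by
  rw [formMap, formMap, tensorPow_smul, Finset.mul_sum]
  exact Finset.sum_congr rfl fun s _ => (mul_smul_comm _ _ _).symm

lemma map_formMap {k R S : Type*} [CommRing k] [CommRing R] [Algebra k R] [CommRing S]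
    [Algebra k S] [Fintype ι] {n : ℕ} (f : R →ₐ[k] S) (A : ι' × (Fin n → ι) → k) (x : ι → R)
    (j : ι') : f (formMap A x j) = formMap A (fun i => f (x i)) j := by
  simp only [formMap, tensorPow, map_sum, map_smul, map_prod]

variable {F : Type*} [Field F] [CharZero F]

lemma absLogHeight_coe [Finite ι] (L : IntermediateField ℚ F) [NumberField L] (x : ι → L) :
    absLogHeight (fun i => (x i : F)) = (finrank ℚ L : ℝ)⁻¹ * logHeight x := by
  let E := IntermediateField.adjoin ℚ (Set.range fun i => (x i : F))
  have hE : E ≤ L := IntermediateField.adjoin_le_iff.2 (by rintro _ ⟨i, rfl⟩; exact (x i).2)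
  let : Algebra E L := (IntermediateField.inclusion hE).toAlgebra
  have : IsScalarTower ℚ E L := .of_algebraMap_eq fun _ => rfl
  have hfin : FiniteDimensional ℚ E :=
    FiniteDimensional.of_injective (IntermediateField.inclusion hE).toLinearMap
      (IntermediateField.inclusion hE).injective
  have : NumberField E := { to_finiteDimensional := hfin }
  have : FiniteDimensional E L := FiniteDimensional.right ℚ E L
  rw [absLogHeight, dif_pos hfin]
  have h := logHeight_algebraMap (K := E) (L := L)
    (fun i => ⟨x i, IntermediateField.subset_adjoin ℚ _ ⟨i, rfl⟩⟩)
  have hx : (fun i => algebraMap E L ⟨x i, IntermediateField.subset_adjoin ℚ _ ⟨i, rfl⟩⟩) = x := rfl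
  rw [hx] at h
  rw [h, ← finrank_mul_finrank ℚ E L]
  have : (finrank E L : ℝ) ≠ 0 := by exact_mod_cast finrank_pos.ne'
  push_cast
  field_simp
  rfl

variable [Algebra.IsAlgebraic ℚ F]

lemma exists_numberField_forall_mem {κ : Type*} [Finite κ] (x : κ → F) :
    ∃ L : IntermediateField ℚ F, NumberField L ∧ ∀ i, x i ∈ L := by
  refine ⟨IntermediateField.adjoin ℚ (Set.range x), { to_finiteDimensional := ?_ }, fun i =>
    IntermediateField.subset_adjoin ℚ _ ⟨i, rfl⟩⟩
  exact IntermediateField.finiteDimensional_adjoin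
    fun y _ => (Algebra.IsAlgebraic.isAlgebraic y).isIntegral

lemma absLogHeight_nonneg [Finite ι] (x : ι → F) : 0 ≤ absLogHeight x := by
  obtain ⟨L, _, hx⟩ := exists_numberField_forall_mem x
  lift x to ι → L using hx
  rw [absLogHeight_coe L x]
  exact mul_nonneg (by positivity) (logHeight_nonneg _)

lemma absLogHeight_smul [Finite ι] (x : ι → F) {c : F} (hc : c ≠ 0) :
    absLogHeight (c • x) = absLogHeight x := by
  obtain ⟨L, _, hL⟩ := exists_numberField_forall_mem (Option.elim · c x)
  have hx := fun i => hL (some i)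
  lift x to ι → L using hx
  lift c to L using hL none
  rw [absLogHeight_coe L x, ← logHeight_smul_eq_logHeight x (c := c) (by simpa using hc),
    ← absLogHeight_coe]
  rfl

lemma absLogHeight_segre [Finite ι] [Finite ι'] {x : ι → F} (hx : x ≠ 0) {y : ι' → F}
    (hy : y ≠ 0) :
    absLogHeight (segre x y) = absLogHeight x + absLogHeight y := by
  obtain ⟨L, _, hL⟩ := exists_numberField_forall_mem (Sum.elim x y)
  have hxL := fun i => hL (.inl i)
  have hyL := fun i => hL (.inr i)
  lift x to ι → L using hxL
  lift y to ι' → L using hyL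
  have hx' : x ≠ 0 := by rintro rfl; exact hx rfl
  have hy' : y ≠ 0 := by rintro rfl; exact hy rfl
  rw [absLogHeight_coe L x, absLogHeight_coe L y, ← mul_add, ← logHeight_fun_mul_eq hx' hy',
    ← absLogHeight_coe]
  rfl

lemma absLogHeight_pow [Finite ι] (x : ι → F) (n : ℕ) :
    absLogHeight (x ^ n) = n * absLogHeight x := by
  obtain ⟨L, _, hL⟩ := exists_numberField_forall_mem x
  lift x to ι → L using hL
  rw [absLogHeight_coe L x, mul_left_comm, ← logHeight_pow, ← absLogHeight_coe]
  rfl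

lemma absLogHeight_mul_le [Finite ι] (x y : ι → F) :
    absLogHeight (x * y) ≤ absLogHeight x + absLogHeight y := by
  obtain ⟨L, _, hL⟩ := exists_numberField_forall_mem (Sum.elim x y)
  have hxL := fun i => hL (.inl i)
  have hyL := fun i => hL (.inr i)
  lift x to ι → L using hxL
  lift y to ι → L using hyL
  rw [absLogHeight_coe L x, absLogHeight_coe L y, ← mul_add]
  refine le_trans (le_of_eq ?_) (mul_le_mul_of_nonneg_left (logHeight_mul_le x y) (by positivity))
  rw [← absLogHeight_coe]
  rfl

lemma absLogHeight_tensorPow [Finite ι] {x : ι → F} (hx : x ≠ 0) (n : ℕ) :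
    absLogHeight (tensorPow x n) = n * absLogHeight x := by
  obtain ⟨L, _, hL⟩ := exists_numberField_forall_mem x
  lift x to ι → L using hL
  have hx' : x ≠ 0 := by rintro rfl; exact hx rfl
  have h := logHeight_fun_prod_eq (α := Fin n) (x := fun _ => x) (fun _ => hx')
  rw [Finset.sum_const, Finset.card_fin, nsmul_eq_mul] at h
  rw [absLogHeight_coe L x, mul_left_comm, ← h, ← absLogHeight_coe]
  congr 1
  ext s
  simp [tensorPow]

lemma absLogHeight_linearMap_le [Fintype ι] [Finite ι'] (A : ι' × ι → F) (x : ι → F) :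
    absLogHeight (fun j => ∑ i, A (j, i) * x i) ≤
      Real.log (Nat.card ι) + absLogHeight A + absLogHeight x := by
  obtain ⟨L, _, hL⟩ := exists_numberField_forall_mem (Sum.elim A x)
  have hxL := fun i => hL (.inl i)
  have hyL := fun i => hL (.inr i)
  lift A to ι' × ι → L using hxL
  lift x to ι → L using hyL
  have h := mul_le_mul_of_nonneg_left (logHeight_linearMap_apply_le A x)
    (show 0 ≤ (finrank ℚ L : ℝ)⁻¹ by positivity)
  have h0 : (finrank ℚ L : ℝ) ≠ 0 := by exact_mod_cast finrank_pos.ne'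
  rw [NumberField.totalWeight_eq_finrank, mul_add, mul_add, inv_mul_cancel_left₀ h0,
    ← absLogHeight_coe, ← absLogHeight_coe, ← absLogHeight_coe] at h
  refine le_trans (le_of_eq ?_) h
  congr 1
  ext j
  simp

lemma exists_absLogHeight_formMap_le {k : Type*} [CommRing k] [Algebra k F] [Fintype ι] [Finite ι']
    {n : ℕ} (A : ι' × (Fin n → ι) → k) :
    ∃ C, ∀ x : ι → F, x ≠ 0 → absLogHeight (formMap A x) ≤ C + n * absLogHeight x := by
  let B := fun p => algebraMap k F (A p)
  refine ⟨Real.log (Nat.card (Fin n → ι)) + absLogHeight B, fun x hx => ?_⟩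
  rw [← absLogHeight_tensorPow hx]
  have hform : formMap A x = fun j => ∑ i, B (j, i) * tensorPow x n i :=
    funext fun j => Finset.sum_congr rfl fun i _ => Algebra.smul_def _ _
  exact hform ▸ absLogHeight_linearMap_le B (tensorPow x n)

lemma exists_absLogHeight_le_add_of_formMap {k : Type*} [CommRing k] [Algebra k F] [Fintype ι]
    [Fintype ι'] {n : ℕ} (A : (ι × ι') × (Fin n → ι × ι') → k) :
    ∃ C, ∀ (x : ι → F) (y : ι' → F) (c : F), x ≠ 0 → y ≠ 0 →
      (∀ i j, x i ^ n * y j ^ (n + 1) = c * (x i * formMap A (segre x y) (i, j))) →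
      absLogHeight y ≤ absLogHeight x + C := by
  obtain ⟨C, hC⟩ := exists_absLogHeight_formMap_le (F := F) A
  refine ⟨C, fun x y c hx hy h => ?_⟩
  have hxn : x ^ n ≠ 0 := pow_ne_zero n hx
  have hyn : y ^ (n + 1) ≠ 0 := pow_ne_zero (n + 1) hy
  have heq : segre (x ^ n) (y ^ (n + 1)) = c • (segre x 1 * formMap A (segre x y)) :=
    funext fun p => by simpa [segre] using h p.1 p.2
  have hne := segre_ne_zero hxn hyn
  have hc : c ≠ 0 := fun hc => hne (by rw [heq, hc, zero_smul])
  have : Nonempty ι' := ⟨(Function.ne_iff.1 hy).choose⟩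
  have h1 : absLogHeight (1 : ι' → F) = 0 := by simpa using absLogHeight_pow (1 : ι' → F) 0
  have hlower : absLogHeight (segre (x ^ n) (y ^ (n + 1))) =
      n * absLogHeight x + (n + 1) * absLogHeight y := by
    rw [absLogHeight_segre hxn hyn, absLogHeight_pow, absLogHeight_pow, Nat.cast_succ]
  have hupper : absLogHeight (segre (x ^ n) (y ^ (n + 1))) ≤
      absLogHeight x + (C + n * (absLogHeight x + absLogHeight y)) := by
    rw [heq, absLogHeight_smul _ hc, ← absLogHeight_segre hx hy]
    refine (absLogHeight_mul_le _ _).trans (add_le_add (le_of_eq ?_) (hC _ (segre_ne_zero hx hy)))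
    rw [absLogHeight_segre hx one_ne_zero, h1, add_zero]
  linarith

end AbsoluteHeight

/-! ### Tuples of rational functions -/

section Tuples

open Filter

variable {k K : Type*} [CommRing k] [Field K] [Algebra k K] {X : Type*} {ι κ : Type*}

/-- The entry `f j` generates the fractional `O`-ideal spanned by the entries of `f`: the map with
homogeneous coordinates `f` is defined at the point with local ring `O`, and sends it to the `j`-th
standard chart. -/
def Dominates (O : Subalgebra k K) (f : ι → K) (j : ι) : Prop :=
  f j ≠ 0 ∧ ∀ i, f i / f j ∈ O

/-- The coordinates `f`, normalized so that a dominating one becomes `1`. -/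
def Dominates.normalize {O : Subalgebra k K} {f : ι → K} {j : ι} (hf : Dominates O f j) : ι → O :=
  fun i => ⟨f i / f j, hf.2 i⟩

lemma Dominates.normalize_self {O : Subalgebra k K} {f : ι → K} {j : ι} (hf : Dominates O f j) :
    hf.normalize j = 1 :=
  Subtype.ext (div_self hf.1)

lemma Dominates.mul_normalize {O : Subalgebra k K} {f : ι → K} {j : ι} (hf : Dominates O f j)
    (i : ι) : f j * hf.normalize i = f i :=
  mul_div_cancel₀ _ hf.1

lemma Dominates.map_normalize_ne_zero {L : Type*} [CommRing L] [Nontrivial L] [Algebra k L]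
    {O : Subalgebra k K} (ev : O →ₐ[k] L) {f : ι → K} {j : ι} (hf : Dominates O f j) :
    (fun i => ev (hf.normalize i)) ≠ 0 :=
  Function.ne_iff.2 ⟨j, by rw [hf.normalize_self, map_one]; exact one_ne_zero⟩

protected lemma Dominates.segre {O : Subalgebra k K} {f : ι → K} {g : κ → K} {j : ι} {l : κ}
    (hf : Dominates O f j) (hg : Dominates O g l) : Dominates O (segre f g) (j, l) :=
  ⟨mul_ne_zero hf.1 hg.1, fun p => by
    simpa only [segre, mul_div_mul_comm] using mul_mem (hf.2 p.1) (hg.2 p.2)⟩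

lemma Dominates.normalize_segre {O : Subalgebra k K} {f : ι → K} {g : κ → K} {j : ι} {l : κ}
    (hf : Dominates O f j) (hg : Dominates O g l) :
    (hf.segre hg).normalize = segre hf.normalize hg.normalize :=
  funext fun _ => Subtype.ext (mul_div_mul_comm _ _ _ _)

lemma Dominates.formMap_eq {O : Subalgebra k K} [Fintype ι] {f : ι → K} {j : ι}
    (hf : Dominates O f j) {M : ℕ} (A : κ × (Fin M → ι) → k) (l : κ) :
    formMap A f l = f j ^ M * (formMap A hf.normalize l : O) := by
  have hval : ((formMap A hf.normalize l : O) : K) = formMap A (fun i => (hf.normalize i : K)) l :=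
    map_formMap O.val _ _ _
  have hsmul : f = f j • fun i => (hf.normalize i : K) :=
    funext fun i => (hf.mul_normalize i).symm
  conv_lhs => rw [hsmul, formMap_smul, ← hval]

lemma Dominates.of_segre {O : Subalgebra k K} {f : ι → K} {g : κ → K} {p : ι × κ}
    (h : Dominates O (segre f g) p) : Dominates O f p.1 ∧ Dominates O g p.2 := by
  have hf : f p.1 ≠ 0 := left_ne_zero_of_mul h.1
  have hg : g p.2 ≠ 0 := right_ne_zero_of_mul h.1
  refine ⟨⟨hf, fun i => ?_⟩, ⟨hg, fun i => ?_⟩⟩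
  · simpa only [segre, mul_div_mul_right _ _ hg] using h.2 (i, p.2)
  · simpa only [segre, mul_div_mul_left _ _ hf] using h.2 (p.1, i)

protected lemma Dominates.tensorPow {O : Subalgebra k K} {f : ι → K} {j : ι}
    (hf : Dominates O f j) (m : ℕ) : Dominates O (tensorPow f m) fun _ => j :=
  ⟨Finset.prod_ne_zero_iff.2 fun _ _ => hf.1, fun s => by
    simpa only [tensorPow, ← Finset.prod_div_distrib] using
      prod_mem fun i _ => hf.2 (s i)⟩

lemma Dominates.smul {O : Subalgebra k K} {f : ι → K} {j : ι} (hf : Dominates O f j) {c : K}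
    (hc : c ≠ 0) : Dominates O (c • f) j :=
  ⟨mul_ne_zero hc hf.1, fun i => by
    simpa only [Pi.smul_apply, smul_eq_mul, mul_div_mul_left _ _ hc] using hf.2 i⟩

lemma Dominates.div_mem {O : Subalgebra k K} {f : ι → K} {g : κ → K} {j i : ι} {l : κ}
    (hf : Dominates O f j) (hg : Dominates O g l) (hi : f i ≠ 0) (h : g l / f i ∈ O) (a : κ) :
    g a / f j ∈ O := by
  have : g a / f j = g a / g l * (g l / f i) * (f i / f j) := by
    rw [div_mul_div_cancel₀ hg.1, div_mul_div_cancel₀ hi]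
  rw [this]
  exact mul_mem (mul_mem (hg.2 a) h) (hf.2 i)

/-- For a family `𝒪` of local rings, the map with homogeneous coordinates `f` is everywhere
defined. -/
def IsBasePointFree (𝒪 : X → Subalgebra k K) (f : ι → K) : Prop :=
  ∀ x, ∃ j, Dominates (𝒪 x) f j

/-! ### Chart algebras and embeddings -/

/-- `O` is the localization of `S` at `𝔭`, inside the common overfield `K`. -/
def IsLocalizationAt (S O : Subalgebra k K) (𝔭 : Ideal S) : Prop :=
  ∀ h : K, h ∈ O ↔ ∃ s t : S, t ∉ 𝔭 ∧ h = s / t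

lemma IsLocalizationAt.le {S O : Subalgebra k K} {𝔭 : Ideal S} [𝔭.IsPrime]
    (h : IsLocalizationAt S O 𝔭) : S ≤ O := fun s hs =>
  (h s).2 ⟨⟨s, hs⟩, 1, 𝔭.one_notMem, by simp⟩

lemma coe_ne_zero_of_notMem {S : Subalgebra k K} {𝔭 : Ideal S} {t : S} (ht : t ∉ 𝔭) :
    (t : K) ≠ 0 := fun h0 =>
  ht (ZeroMemClass.coe_eq_zero.1 h0 ▸ zero_mem 𝔭)

section Overring

variable {S R O : Subalgebra k K} (hSR : S ≤ R) {𝔪 : Ideal R} [h𝔪 : 𝔪.IsPrime]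

include h𝔪

lemma IsLocalizationAt.inv_mem (h : IsLocalizationAt S O (𝔪.comap (Subalgebra.inclusion hSR)))
    {f : K} (hf : f ∈ O) {r t : R} (ht : t ∉ 𝔪) (hfrt : f * r = t) : f⁻¹ ∈ O := by
  obtain ⟨s, τ, hτ, rfl⟩ := (h f).1 hf
  have hτ0 := coe_ne_zero_of_notMem hτ
  have hmul : t * Subalgebra.inclusion hSR τ = Subalgebra.inclusion hSR s * r := by
    refine Subtype.ext (show (t : K) * τ = s * r from ?_)
    rw [← hfrt, mul_right_comm, div_mul_cancel₀ _ hτ0]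
  have hs : s ∉ 𝔪.comap (Subalgebra.inclusion hSR) := fun hs =>
    (h𝔪.mem_or_mem (hmul ▸ 𝔪.mul_mem_right r hs)).elim ht hτ
  exact (h _).2 ⟨τ, s, hs, inv_div _ _⟩

lemma IsLocalizationAt.of_le (h : IsLocalizationAt S O (𝔪.comap (Subalgebra.inclusion hSR)))
    (hRO : R ≤ O) : IsLocalizationAt R O 𝔪 := by
  refine fun f => ⟨fun hf => ?_, ?_⟩
  · obtain ⟨s, t, ht, rfl⟩ := (h f).1 hf
    exact ⟨Subalgebra.inclusion hSR s, Subalgebra.inclusion hSR t, ht, rfl⟩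
  · rintro ⟨r, t, ht, rfl⟩
    have hinv : (t : K)⁻¹ ∈ O := h.inv_mem hSR (hRO t.2) (r := 1) ht (mul_one _)
    rw [div_eq_mul_inv]
    exact mul_mem (hRO r.2) hinv

end Overring

lemma mem_of_forall_isPrime_mem_localization {S : Subalgebra k K} {h : K}
    (H : ∀ 𝔭 : Ideal S, 𝔭.IsPrime → ∃ s t : S, t ∉ 𝔭 ∧ h = s / t) : h ∈ S := by
  let denominators : Ideal S :=
    { carrier := {t | (t : K) * h ∈ S}
      add_mem' := fun ha hb => by
        simpa only [Set.mem_ofPred_eq, Subalgebra.coe_add, add_mul] using add_mem ha hb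
      zero_mem' := by simp
      smul_mem' := fun c t ht => by
        simpa only [Set.mem_ofPred_eq, smul_eq_mul, Subalgebra.coe_mul, mul_assoc] using
          mul_mem c.2 ht }
  suffices (1 : S) ∈ denominators by simpa [denominators] using this
  by_contra h1
  obtain ⟨𝔭, h𝔭, hle⟩ := Ideal.exists_le_maximal denominators ((Ideal.ne_top_iff_one _).2 h1)
  obtain ⟨s, t, ht, rfl⟩ := H 𝔭 h𝔭.isPrime
  have hmem : (t : K) * (s / t) ∈ S := by
    rw [mul_div_cancel₀ _ (coe_ne_zero_of_notMem ht)]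
    exact s.2
  exact ht (hle hmem)

lemma IsLocalizationAt.exists_common_denominator [Finite κ] {S O : Subalgebra k K} {𝔭 : Ideal S}
    [h𝔭 : 𝔭.IsPrime] (h : IsLocalizationAt S O 𝔭) {f : κ → K} (hf : ∀ a, f a ∈ O) :
    ∃ d : S, d ∉ 𝔭 ∧ ∀ a, d * f a ∈ S := by
  classical
  cases nonempty_fintype κ
  choose num den hden hquot using fun a => (h _).1 (hf a)
  refine ⟨∏ a, den a, fun hmem => ?_, fun a => ?_⟩
  · obtain ⟨a, -, ha⟩ := Ideal.IsPrime.prod_mem_iff.1 hmem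
    exact hden a ha
  · rw [hquot, ← Finset.prod_erase_mul _ _ (Finset.mem_univ a), Subalgebra.coe_mul, mul_assoc,
      mul_div_cancel₀ _ (coe_ne_zero_of_notMem (hden a))]
    exact mul_mem (SetLike.coe_mem _) (num a).2

variable (k) in
/-- The coordinate ring of the part of the image of the map with homogeneous coordinates `e` lying
in the chart where the `q`-th coordinate does not vanish. -/
def chartAlgebra (e : ι → K) (q : ι) : Subalgebra k K :=
  Algebra.adjoin k (Set.range fun c => e c / e q)

lemma div_mem_chartAlgebra (e : ι → K) (c q : ι) : e c / e q ∈ chartAlgebra k e q :=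
  Algebra.subset_adjoin ⟨c, rfl⟩

lemma Dominates.chartAlgebra_le {O : Subalgebra k K} {e : ι → K} {q : ι} (h : Dominates O e q) :
    chartAlgebra k e q ≤ O :=
  Algebra.adjoin_le (Set.range_subset_iff.2 h.2)

/-- The map with homogeneous coordinates `e`, from a variety with local rings `𝒪 x`, is a closed
embedding: the local rings of the coordinate rings of its image are among the `𝒪 x`. -/
def IsEmbedding (𝒪 : X → Subalgebra k K) (e : ι → K) : Prop :=
  ∀ q, e q ≠ 0 → ∀ 𝔭 : Ideal (chartAlgebra k e q), 𝔭.IsPrime →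
    ∃ x, IsLocalizationAt (chartAlgebra k e q) (𝒪 x) 𝔭

lemma IsEmbedding.mem_chartAlgebra {𝒪 : X → Subalgebra k K} {e : ι → K} (he : IsEmbedding 𝒪 e)
    {q : ι} (hq : e q ≠ 0) {h : K} (hh : ∀ x, chartAlgebra k e q ≤ 𝒪 x → h ∈ 𝒪 x) :
    h ∈ chartAlgebra k e q :=
  mem_of_forall_isPrime_mem_localization fun 𝔭 h𝔭 =>
    have ⟨x, hx⟩ := he q hq 𝔭 h𝔭
    (hx h).1 (hh x hx.le)

lemma chartAlgebra_le_chartAlgebra_segre {f : ι → K} {e : κ → K} {j : ι} (hj : f j ≠ 0) (l : κ) :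
    chartAlgebra k e l ≤ chartAlgebra k (segre f e) (j, l) :=
  Algebra.adjoin_le <| Set.range_subset_iff.2 fun c => by
    simpa only [segre, mul_div_mul_left _ _ hj, SetLike.mem_coe] using
      div_mem_chartAlgebra (k := k) (segre f e) (j, c) (j, l)

protected lemma IsEmbedding.segre {𝒪 : X → Subalgebra k K} {f : ι → K} {e : κ → K}
    (he : IsEmbedding 𝒪 e) (hf : IsBasePointFree 𝒪 f) : IsEmbedding 𝒪 (segre f e) := by
  rintro ⟨j, l⟩ hjl 𝔪 h𝔪
  have hj : f j ≠ 0 := left_ne_zero_of_mul hjl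
  have hl : e l ≠ 0 := right_ne_zero_of_mul hjl
  have hSR := chartAlgebra_le_chartAlgebra_segre (k := k) (e := e) hj l
  obtain ⟨x, hx⟩ := he l hl (𝔪.comap (Subalgebra.inclusion hSR)) inferInstance
  refine ⟨x, hx.of_le hSR (Algebra.adjoin_le ?_)⟩
  obtain ⟨i, hi0, hi⟩ := hf x
  have hRij : f i / f j ∈ chartAlgebra k (segre f e) (j, l) := by
    simpa only [segre, mul_div_mul_right _ _ hl] using
      div_mem_chartAlgebra (k := k) (segre f e) (i, l) (j, l)
  have hij : f i / f j ∈ 𝒪 x := by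
    have := hx.inv_mem hSR (hi j) (r := ⟨_, hRij⟩) (t := 1) 𝔪.one_notMem (by
      simp [div_mul_div_cancel₀ hi0, hj])
    rwa [inv_div] at this
  rintro _ ⟨⟨a, c⟩, rfl⟩
  have : f a * e c / (f j * e l) = f a / f i * (f i / f j) * (e c / e l) := by
    rw [div_mul_div_cancel₀ hi0, mul_div_mul_comm]
  rw [SetLike.mem_coe]
  exact (congrArg (· ∈ 𝒪 x) this).mpr
    (mul_mem (mul_mem (hi a) hij) (hx.le (div_mem_chartAlgebra e c l)))

/-! ### Forms -/

lemma eventually_mem_span_pow {W : Submodule k K} (h1 : 1 ≤ W) {h : K}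
    (hh : h ∈ Algebra.adjoin k (W : Set K)) : ∀ᶠ M : ℕ in atTop, h ∈ W ^ M := by
  have hmono {m n : ℕ} (hmn : m ≤ n) : W ^ m ≤ W ^ n := pow_le_pow_right' h1 hmn
  suffices ∃ M : ℕ, h ∈ W ^ M from
    this.elim fun M hM => (eventually_ge_atTop M).mono fun N hN => hmono hN hM
  induction hh using Algebra.adjoin_induction with
  | mem x hx => exact ⟨1, by simpa using hx⟩
  | algebraMap r => exact ⟨0, by rw [pow_zero]; exact Submodule.algebraMap_mem r⟩
  | add x y _ _ hx hy =>
    obtain ⟨m, hm⟩ := hx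
    obtain ⟨n, hn⟩ := hy
    exact ⟨m + n, add_mem (hmono (Nat.le_add_right m n) hm) (hmono (Nat.le_add_left n m) hn)⟩
  | mul x y _ _ hx hy =>
    obtain ⟨m, hm⟩ := hx
    obtain ⟨n, hn⟩ := hy
    exact ⟨m + n, pow_add W m n ▸ Submodule.mul_mem_mul hm hn⟩

lemma span_range_pow (w : ι → K) (M : ℕ) :
    Submodule.span k (Set.range w) ^ M = Submodule.span k (Set.range (tensorPow w M)) := by
  rw [Submodule.span_pow]
  congr 1
  ext x
  simp only [Set.mem_pow, List.prod_ofFn, Set.mem_range, tensorPow]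
  constructor
  · rintro ⟨g, rfl⟩
    choose s hs using fun i => (g i).2
    exact ⟨s, Finset.prod_congr rfl fun i _ => hs i⟩
  · rintro ⟨s, rfl⟩
    exact ⟨fun i => ⟨w (s i), s i, rfl⟩, rfl⟩

lemma eventually_exists_form [Fintype ι] {e : ι → K} {q : ι} (hq : e q ≠ 0) {h : K}
    (hh : h ∈ chartAlgebra k e q) :
    ∀ᶠ M : ℕ in atTop, ∃ A : (Fin M → ι) → k, h * e q ^ M = ∑ s, A s • tensorPow e M s := by
  classical
  let w : ι → K := fun c => e c / e q
  have h1 : 1 ≤ Submodule.span k (Set.range w) :=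
    Submodule.one_le.2 (Submodule.subset_span ⟨q, div_self hq⟩)
  have hh' : h ∈ Algebra.adjoin k (Submodule.span k (Set.range w) : Set K) := by
    rwa [Algebra.adjoin_span]
  filter_upwards [eventually_mem_span_pow h1 hh'] with M hM
  rw [span_range_pow, Submodule.mem_span_range_iff_exists_fun] at hM
  obtain ⟨A, rfl⟩ := hM
  have hew : e = e q • w := by ext c; exact (mul_div_cancel₀ _ hq).symm
  refine ⟨A, ?_⟩
  conv_rhs => rw [hew, tensorPow_smul]
  rw [Finset.sum_mul]
  exact Finset.sum_congr rfl fun s _ => by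
    rw [Pi.smul_apply, smul_eq_mul, mul_comm, mul_smul_comm]

lemma eventually_exists_formMap [Fintype ι] [Finite κ] {e : ι → K} {q : κ → ι} {h : κ → K}
    (hh : ∀ l, e (q l) ≠ 0 → h l ∈ chartAlgebra k e (q l)) :
    ∀ᶠ M : ℕ in atTop, ∃ A : κ × (Fin M → ι) → k, ∀ l, h l * e (q l) ^ M = formMap A e l := by
  suffices ∀ l, ∀ᶠ M : ℕ in atTop, ∃ A : (Fin M → ι) → k,
      h l * e (q l) ^ M = ∑ s, A s • tensorPow e M s by
    filter_upwards [eventually_all.2 this] with M hM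
    choose A hA using hM
    exact ⟨fun p => A p.1 p.2, hA⟩
  intro l
  by_cases hq : e (q l) = 0
  · filter_upwards [eventually_ne_atTop 0] with M hM
    exact ⟨0, by simp [hq, hM]⟩
  · exact eventually_exists_form hq (hh l hq)

end Tuples

/-! ### Heights of tuples of rational functions -/

section TupleHeights

open Filter

variable {k K L : Type*} [CommRing k] [Field K] [Algebra k K] [Field L] [CharZero L] [Algebra k L]
  {X ι κ : Type*}

open Classical in
/-- The height of the value of the map with homogeneous coordinates `f` at the `L`-point given by
the evaluation `ev` on the local ring `O`. The value is `0` if the map is not defined there. -/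
def heightAt {O : Subalgebra k K} (ev : O →ₐ[k] L) (f : ι → K) : ℝ :=
  if h : ∃ j, Dominates O f j then absLogHeight fun i => ev (h.choose_spec.normalize i) else 0

variable [Algebra.IsAlgebraic ℚ L] [Finite ι] [Finite κ] {O : Subalgebra k K} (ev : O →ₐ[k] L)
  {f : ι → K} {g : κ → K} {j : ι} {l : κ}

lemma Dominates.heightAt_eq_of_proportional (hf : Dominates O f j) {y : ι → O}
    (hy : (fun i => ev (y i)) ≠ 0) (hfy : ∀ i j, f i * y j = f j * y i) :
    heightAt ev f = absLogHeight fun i => ev (y i) := by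
  have hex : ∃ j, Dominates O f j := ⟨j, hf⟩
  have hl := hex.choose_spec
  set l := hex.choose
  have hyl (i : ι) : y i = hl.normalize i * y l := by
    refine Subtype.ext (mul_left_cancel₀ hl.1 ?_)
    rw [Subalgebra.coe_mul, ← mul_assoc, hl.mul_normalize, hfy]
  have hev : (fun i => ev (y i)) = ev (y l) • fun i => ev (hl.normalize i) := by
    ext i
    rw [hyl, map_mul, Pi.smul_apply, smul_eq_mul, mul_comm]
  have hne : ev (y l) ≠ 0 := fun h0 => hy (by rw [hev, h0, zero_smul])
  rw [heightAt, dif_pos hex, hev, absLogHeight_smul _ hne]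

lemma Dominates.heightAt_eq (hf : Dominates O f j) :
    heightAt ev f = absLogHeight fun i => ev (hf.normalize i) :=
  hf.heightAt_eq_of_proportional ev (hf.map_normalize_ne_zero ev) fun _ _ =>
    mul_div_left_comm _ _ _

lemma Dominates.heightAt_smul (hf : Dominates O f j) {c : K} (hc : c ≠ 0) :
    heightAt ev (c • f) = heightAt ev f := by
  rw [hf.heightAt_eq]
  refine (hf.smul hc).heightAt_eq_of_proportional ev (hf.map_normalize_ne_zero ev) fun i l => ?_
  simp only [Pi.smul_apply, smul_eq_mul, mul_assoc]
  exact congrArg (c * ·) (mul_div_left_comm _ _ _)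

lemma Dominates.heightAt_segre (hf : Dominates O f j) (hg : Dominates O g l) :
    heightAt ev (segre f g) = heightAt ev f + heightAt ev g := by
  rw [(hf.segre hg).heightAt_eq, hf.heightAt_eq, hg.heightAt_eq, hf.normalize_segre hg, map_segre,
    absLogHeight_segre (hf.map_normalize_ne_zero ev) (hg.map_normalize_ne_zero ev)]

lemma Dominates.heightAt_tensorPow (hf : Dominates O f j) (m : ℕ) :
    heightAt ev (tensorPow f m) = m * heightAt ev f := by
  rw [(hf.tensorPow m).heightAt_eq, hf.heightAt_eq,
    ← absLogHeight_tensorPow (hf.map_normalize_ne_zero ev)]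
  congr 1
  ext s
  rw [tensorPow, ← map_prod]
  refine congrArg ev (Subtype.ext ?_)
  rw [SubmonoidClass.coe_finsetProd]
  exact (Finset.prod_div_distrib (fun i => f (s i)) fun _ => f j).symm

lemma heightAt_nonneg : 0 ≤ heightAt ev f := by
  by_cases h : ∃ j, Dominates O f j
  · rw [h.choose_spec.heightAt_eq]
    exact absLogHeight_nonneg _
  · rw [heightAt, dif_neg h]

end TupleHeights

/-! ### Comparison of heights -/

section Comparison

open Filter

variable {k K : Type*} [CommRing k] [Field K] [Algebra k K] {X ι κ : Type*}
  {𝒪 : X → Subalgebra k K}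

lemma exists_formMap_segre_eq [Fintype ι] [Fintype κ] {s : ι → K} {t : κ → K}
    (hs : IsBasePointFree 𝒪 s) (ht : IsEmbedding 𝒪 t)
    (hts : ∀ x j l, Dominates (𝒪 x) s j → Dominates (𝒪 x) t l → t l / s j ∈ 𝒪 x) :
    ∃ (M : ℕ) (A : (ι × κ) × (Fin M → ι × κ) → k), ∀ j l,
      s j ^ M * t l ^ (M + 1) = s j * formMap A (segre s t) (j, l) := by
  have hquot (p : ι × κ) (hp : segre s t p ≠ 0) :
      t p.2 / s p.1 ∈ chartAlgebra k (segre s t) p := by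
    refine (ht.segre hs).mem_chartAlgebra hp fun x hx => ?_
    obtain ⟨hsx, htx⟩ := Dominates.of_segre ⟨hp, fun c => hx (div_mem_chartAlgebra _ c p)⟩
    exact hts x p.1 p.2 hsx htx
  obtain ⟨M, ⟨A, hA⟩, hM⟩ :=
    ((eventually_exists_formMap hquot).and (eventually_ne_atTop 0)).exists
  refine ⟨M, A, fun j l => ?_⟩
  rw [← hA (j, l), segre, mul_pow]
  rcases eq_or_ne (s j) 0 with h0 | h0
  · simp [h0, hM]
  · field_simp
    ring

lemma Dominates.normalize_formMap_eq [Fintype ι] [Fintype κ] {O : Subalgebra k K} {s : ι → K}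
    {t : κ → K} {M : ℕ} {A : (ι × κ) × (Fin M → ι × κ) → k} {j₀ : ι} {l₀ : κ}
    (hs : Dominates O s j₀) (ht : Dominates O t l₀) (hst : s j₀ / t l₀ ∈ O)
    (hA : ∀ j l, s j ^ M * t l ^ (M + 1) = s j * formMap A (segre s t) (j, l)) (j : ι) (l : κ) :
    hs.normalize j ^ M * ht.normalize l ^ (M + 1) =
      ⟨_, hst⟩ * (hs.normalize j * formMap A (segre hs.normalize ht.normalize) (j, l)) := by
  refine Subtype.ext (mul_left_cancel₀ (pow_ne_zero M (hs.segre ht).1) ?_)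
  have h := hA j l
  rw [(hs.segre ht).formMap_eq, hs.normalize_segre ht, ← hs.mul_normalize j,
    ← ht.mul_normalize l] at h
  have ht0 := ht.1
  simp only [Subalgebra.coe_mul, Subalgebra.coe_pow, segre] at h ⊢
  field_simp
  linear_combination h

variable {L : Type*} [Field L] [CharZero L] [Algebra.IsAlgebraic ℚ L] [Algebra k L]

lemma exists_heightAt_le_add [Finite ι] [Finite κ] {s : ι → K} {t : κ → K}
    (hs : IsBasePointFree 𝒪 s) (ht : IsBasePointFree 𝒪 t) (hte : IsEmbedding 𝒪 t)
    (hts : ∀ x j l, Dominates (𝒪 x) s j → Dominates (𝒪 x) t l → t l / s j ∈ 𝒪 x)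
    (hst : ∀ x j l, Dominates (𝒪 x) s j → Dominates (𝒪 x) t l → s j / t l ∈ 𝒪 x) :
    ∃ C, ∀ (x : X) (ev : 𝒪 x →ₐ[k] L), heightAt ev t ≤ heightAt ev s + C := by
  cases nonempty_fintype ι
  cases nonempty_fintype κ
  obtain ⟨M, A, hA⟩ := exists_formMap_segre_eq hs hte hts
  obtain ⟨C, hC⟩ := exists_absLogHeight_le_add_of_formMap (F := L) A
  refine ⟨C, fun x ev => ?_⟩
  obtain ⟨j, hj⟩ := hs x
  obtain ⟨l, hl⟩ := ht x
  rw [hj.heightAt_eq, hl.heightAt_eq]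
  refine hC _ _ (ev ⟨_, hst x j l hj hl⟩) (hj.map_normalize_ne_zero ev)
    (hl.map_normalize_ne_zero ev) fun a b => ?_
  have h := congrArg ev (hj.normalize_formMap_eq hl (hst x j l hj hl) hA a b)
  rw [map_mul, map_mul, map_mul, map_pow, map_pow, map_formMap] at h
  simpa only [map_segre] using h

/-! ### Upper bounds -/

/-- `g` clears the denominators of the quotients of the entries of `f` by one of them. -/
def ClearsDenominators (S : Subalgebra k K) (f : κ → K) (g : K) : Prop :=
  ∃ j, f j ≠ 0 ∧ ∀ a, g * (f a / f j) ∈ S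

lemma IsEmbedding.exists_finset_clearsDenominators [Finite κ] {e : ι → K} {f : κ → K}
    (he : IsEmbedding 𝒪 e) (hf : IsBasePointFree 𝒪 f) {q : ι} (hq : e q ≠ 0) :
    ∃ T : Finset (chartAlgebra k e q), Ideal.span (T : Set (chartAlgebra k e q)) = ⊤ ∧
      ∀ g ∈ T, ClearsDenominators (chartAlgebra k e q) f g := by
  set S := chartAlgebra k e q
  suffices Ideal.span {g : S | ClearsDenominators S f g} = ⊤ by
    obtain ⟨T, hT, hspan⟩ := (Ideal.span_eq_top_iff_finite _).1 this
    exact ⟨T, hspan, hT⟩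
  by_contra hne
  obtain ⟨𝔭, h𝔭, hle⟩ := Ideal.exists_le_maximal _ hne
  obtain ⟨x, hx⟩ := he q hq 𝔭 h𝔭.isPrime
  obtain ⟨j, hj0, hj⟩ := hf x
  obtain ⟨g, hg, hgS⟩ := hx.exists_common_denominator hj
  exact hg (hle (Ideal.subset_span ⟨j, hj0, hgS⟩))

lemma ClearsDenominators.eventually_heightAt_le [Finite ι] [Finite κ] {e : ι → K} {f : κ → K}
    {q : ι} (hq : e q ≠ 0) {g : chartAlgebra k e q}
    (hg : ClearsDenominators (chartAlgebra k e q) f g) :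
    ∀ᶠ C : ℝ in atTop, ∀ (O : Subalgebra k K) (ev : O →ₐ[k] L) (h : Dominates O e q),
      ev (Subalgebra.inclusion h.chartAlgebra_le g) ≠ 0 → (∃ i, Dominates O f i) →
        heightAt ev f ≤ C * heightAt ev e + C := by
  cases nonempty_fintype ι
  cases nonempty_fintype κ
  obtain ⟨j, hj0, hj⟩ := hg
  obtain ⟨M, A, hA⟩ := (eventually_exists_formMap (q := fun _ : κ => q) fun a _ => hj a).exists
  obtain ⟨B, hB⟩ := exists_absLogHeight_formMap_le (F := L) A
  filter_upwards [eventually_ge_atTop (M : ℝ), eventually_ge_atTop B] with C hMC hBC O ev he hev hf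
  obtain ⟨i, hi⟩ := hf
  let y : κ → O := fun a => ⟨g * (f a / f j), he.chartAlgebra_le (hj a)⟩
  have hy : y = formMap A he.normalize := funext fun a => Subtype.ext <| by
    refine mul_left_cancel₀ (pow_ne_zero M hq) ?_
    rw [← he.formMap_eq, ← hA, mul_comm]
  have hyj : y j = Subalgebra.inclusion he.chartAlgebra_le g := Subtype.ext <| by
    simp only [y, div_self hj0, mul_one, Subalgebra.coe_inclusion]
  have hevy : (fun a => ev (y a)) ≠ 0 := Function.ne_iff.2 ⟨j, by rw [hyj]; exact hev⟩
  calc heightAt ev f = absLogHeight fun a => ev (y a) :=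
        hi.heightAt_eq_of_proportional ev hevy fun a b => by simp only [y]; ring
    _ = absLogHeight (formMap A fun c => ev (he.normalize c)) := by simp only [hy, map_formMap]
    _ ≤ B + M * heightAt ev e := he.heightAt_eq ev ▸ hB _ (he.map_normalize_ne_zero ev)
    _ ≤ C * heightAt ev e + C := by nlinarith [heightAt_nonneg ev (f := e)]

lemma IsEmbedding.exists_heightAt_le [Finite ι] [Finite κ] {e : ι → K} {f : κ → K}
    (he : IsEmbedding 𝒪 e) (he' : IsBasePointFree 𝒪 e) (hf : IsBasePointFree 𝒪 f) :
    ∃ C, 0 ≤ C ∧ ∀ (x : X) (ev : 𝒪 x →ₐ[k] L), heightAt ev f ≤ C * heightAt ev e + C := by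
  have hchart (q : ι) : ∀ᶠ C : ℝ in atTop, ∀ (x : X) (ev : 𝒪 x →ₐ[k] L),
      Dominates (𝒪 x) e q → heightAt ev f ≤ C * heightAt ev e + C := by
    by_cases hq : e q = 0
    · exact .of_forall fun C x ev h => absurd hq h.1
    obtain ⟨T, hspan, hT⟩ := he.exists_finset_clearsDenominators hf hq
    filter_upwards [T.eventually_all.2 fun g hg => (hT g hg).eventually_heightAt_le (L := L) hq]
      with C hC x ev hx
    let restricted := ev.comp (Subalgebra.inclusion hx.chartAlgebra_le)
    obtain ⟨g, hg, hgev⟩ : ∃ g ∈ T, restricted g ≠ 0 := by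
      by_contra! hker
      have : Ideal.span (T : Set (chartAlgebra k e q)) ≤ RingHom.ker restricted :=
        Ideal.span_le.2 hker
      exact RingHom.ker_ne_top restricted (top_le_iff.1 (hspan ▸ this))
    exact hC g hg (𝒪 x) ev hx hgev (hf x)
  obtain ⟨C, hC, hC0⟩ := ((eventually_all.2 hchart).and (eventually_ge_atTop 0)).exists
  exact ⟨C, hC0, fun x ev => (he' x).elim fun q hq => hC q x ev hq⟩

end Comparison

/-! ### Points of projective space with values in a ring -/

section ProjectivePoints

open HomogeneousLocalization

variable {k : Type u} [Field k] {n : ℕ} {R S : CommRingCat.{u}}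

/-- The value in `R` of a section over an open set containing the image of an `R`-point. -/
def evalHom {X : Scheme.{u}} (p : Spec R ⟶ X) (U : X.Opens) (hU : ⊤ ≤ p ⁻¹ᵁ U) : Γ(X, U) →+* R :=
  (Scheme.ΓSpecIso R).hom.hom.comp (p.appLE U ⊤ hU).hom

lemma evalHom_comp {X Y : Scheme.{u}} (p : Spec R ⟶ X) (φ : X ⟶ Y) (W : Y.Opens)
    (hW : ⊤ ≤ (p ≫ φ) ⁻¹ᵁ W) (s : Γ(Y, W)) :
    evalHom (p ≫ φ) W hW s = evalHom p (φ ⁻¹ᵁ W) hW (φ.app W s) := by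
  have h := Scheme.Hom.appLE_comp_appLE p φ W (φ ⁻¹ᵁ W) ⊤ le_rfl hW
  rw [Scheme.Hom.appLE_eq_app] at h
  exact congrArg (fun f => (Scheme.ΓSpecIso R).hom (f.hom s)) h.symm

lemma evalHom_of_specMap_comp_eq {X : Scheme.{u}} {p : Spec R ⟶ X} {q : Spec S ⟶ X} {f : R ⟶ S}
    (hpq : Spec.map f ≫ p = q) {U : X.Opens} (hp : ⊤ ≤ p ⁻¹ᵁ U) (hq : ⊤ ≤ q ⁻¹ᵁ U) (s : Γ(X, U)) :
    evalHom q U hq s = f (evalHom p U hp s) := by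
  subst hpq
  have h := Scheme.Hom.appLE_comp_appLE (Spec.map f) p U ⊤ ⊤ hp le_top
  have htop : (Spec.map f).appLE ⊤ ⊤ le_top = (Spec.map f).appTop := Scheme.Hom.appLE_eq_app _
  have heval : (Spec.map f ≫ p).appLE U ⊤ hq ≫ (Scheme.ΓSpecIso S).hom =
      p.appLE U ⊤ hp ≫ (Scheme.ΓSpecIso R).hom ≫ f := by
    rw [← Scheme.ΓSpecIso_naturality, ← h, htop, Category.assoc]
  exact congrArg (fun g => g.hom s) heval

lemma top_le_fromSpecStalk_preimage {X : Scheme.{u}} {U : X.Opens} {x : X} (hx : x ∈ U) :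
    ⊤ ≤ X.fromSpecStalk x ⁻¹ᵁ U := fun y _ => by
  have hy : X.fromSpecStalk x y ⤳ x := by
    have h := Set.mem_range_self (f := X.fromSpecStalk x) y
    rwa [Scheme.range_fromSpecStalk] at h
  exact hy.mem_open U.2 hx

lemma evalHom_fromSpecStalk {X : Scheme.{u}} {U : X.Opens} {x : X} (hx : x ∈ U) (s : Γ(X, U)) :
    evalHom (X.fromSpecStalk x) U (top_le_fromSpecStalk_preimage hx) s =
      X.presheaf.germ U x hx s := by
  have h : (X.fromSpecStalk x).appLE U ⊤ (top_le_fromSpecStalk_preimage hx) ≫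
      (Scheme.ΓSpecIso _).hom = X.presheaf.germ U x hx := by
    rw [Scheme.Hom.appLE, Scheme.fromSpecStalk_app hx,
      Category.assoc, Category.assoc, Category.assoc, ← Functor.map_comp_assoc]
    have hid := (Spec (X.presheaf.stalk x)).presheaf.map_id (.op ⊤)
    exact (X.presheaf.germ U x hx ≫= (Scheme.ΓSpecIso _).inv ≫=
      (hid =≫ (Scheme.ΓSpecIso _).hom).trans (Category.id_comp _)).trans (by simp)
  exact congrArg (fun f => f.hom s) h

lemma evalHom_awayι {f : MvPolynomial (Fin (n + 1)) k} {m : ℕ} (hf : f ∈ grading k n m)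
    (hm : 0 < m) (h : ⊤ ≤ Proj.awayι (grading k n) f hf hm ⁻¹ᵁ Proj.basicOpen (grading k n) f)
    (a : Away (grading k n) f) :
    evalHom (Proj.awayι (grading k n) f hf hm) _ h (Proj.awayToSection (grading k n) f a) = a := by
  let e := Proj.basicOpenIsoSpec (grading k n) f hf hm
  let D := Proj.basicOpen (grading k n) f
  have hι : (Proj.awayι (grading k n) f hf hm).appLE D ⊤ h = D.topIso.inv ≫ e.inv.appTop := by
    have hcomp := Scheme.Hom.appLE_comp_appLE e.inv D.ι D ⊤ ⊤ D.ι_preimage_self.ge le_top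
    have htop : e.inv.appLE ⊤ ⊤ le_top = e.inv.appTop := Scheme.Hom.appLE_eq_app _
    refine hcomp.symm.trans ?_
    rw [htop]
    simp only [Scheme.Opens.topIso_inv]
    have hres : D.ι.appLE D ⊤ D.ι_preimage_self.ge =
        (ProjSpace k n).presheaf.map (eqToHom (D.ι_image_top)).op := by
      rw [Scheme.Hom.appLE, Scheme.Opens.ι_app]
      exact ((ProjSpace k n).presheaf.map_comp _ _).symm
    rw [hres]
    rfl
  have hsec : Proj.awayToSection (grading k n) f ≫ D.topIso.inv =
      (Scheme.ΓSpecIso _).inv ≫ e.hom.appTop :=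
    (Iso.eq_inv_comp _).2 (Proj.basicOpenToSpec_app_top (grading k n) f).symm
  have hid : Proj.awayToSection (grading k n) f ≫
      (Proj.awayι (grading k n) f hf hm).appLE D ⊤ h ≫ (Scheme.ΓSpecIso _).hom = 𝟙 _ := by
    rw [hι, Category.assoc, reassoc_of% hsec, ← Scheme.Hom.comp_appTop_assoc, e.inv_hom_id,
      Scheme.Hom.id_appTop, Category.id_comp, Iso.inv_hom_id]
  exact congrArg (fun g => g.hom a) hid

lemma evalHom_awayToSection {p : Spec R ⟶ ProjSpace k n} {f : MvPolynomial (Fin (n + 1)) k}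
    {m : ℕ} {hf : f ∈ grading k n m} {hm : 0 < m} {g : Away (grading k n) f →+* R}
    (hg : Spec.map (CommRingCat.ofHom g) ≫ Proj.awayι (grading k n) f hf hm = p)
    (hp : ⊤ ≤ p ⁻¹ᵁ Proj.basicOpen (grading k n) f) (a : Away (grading k n) f) :
    evalHom p _ hp (Proj.awayToSection (grading k n) f a) = g a := by
  subst hg
  have h : ⊤ ≤ Proj.awayι (grading k n) f hf hm ⁻¹ᵁ Proj.basicOpen (grading k n) f := by
    rw [← Proj.opensRange_awayι (grading k n) f hf hm, Scheme.Hom.preimage_opensRange]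
  exact (evalHom_of_specMap_comp_eq rfl h hp _).trans (congrArg g (evalHom_awayι hf hm h a))

lemma exists_specMap_awayι_eq {p : Spec R ⟶ ProjSpace k n} {f : MvPolynomial (Fin (n + 1)) k}
    {m : ℕ} (hf : f ∈ grading k n m) (hm : 0 < m)
    (hp : ⊤ ≤ p ⁻¹ᵁ Proj.basicOpen (grading k n) f) :
    ∃ g : Away (grading k n) f →+* R,
      Spec.map (CommRingCat.ofHom g) ≫ Proj.awayι (grading k n) f hf hm = p := by
  have hrange : Set.range p ⊆ Set.range (Proj.awayι (grading k n) f hf hm) := by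
    rintro _ ⟨x, rfl⟩
    rw [← Scheme.Hom.coe_opensRange, Proj.opensRange_awayι]
    exact hp (Set.mem_univ x)
  refine ⟨(Spec.preimage (IsOpenImmersion.lift _ p hrange)).hom, ?_⟩
  rw [CommRingCat.ofHom_hom, Spec.map_preimage, IsOpenImmersion.lift_fac]

/-- The fraction `ℓ / Xⱼ` in the degree zero part of the localization at `Xⱼ`. -/
def awayRatio (ℓ : grading k n 1) (j : Fin (n + 1)) :
    Away (grading k n) (MvPolynomial.X j : MvPolynomial (Fin (n + 1)) k) :=
  Away.mk (grading k n) (X_mem_grading k n j) 1 ℓ.1 (by simp)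

lemma val_awayRatio (ℓ : grading k n 1) (j : Fin (n + 1)) :
    (awayRatio ℓ j).val = Localization.mk ℓ.1 ⟨MvPolynomial.X j, Submonoid.mem_powers _⟩ := by
  rw [awayRatio, Away.val_mk]
  congr 2
  simp

lemma val_awayMap_awayRatio (ℓ : grading k n 1) (i j : Fin (n + 1))
    {x : MvPolynomial (Fin (n + 1)) k} (hx : x = MvPolynomial.X j * MvPolynomial.X i) :
    (awayMap (grading k n) (X_mem_grading k n i) hx (awayRatio ℓ j)).val =
      Localization.mk (ℓ.1 * MvPolynomial.X i) ⟨x, Submonoid.mem_powers _⟩ := by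
  have h := val_awayMap_mk (grading k n) (X_mem_grading k n i) hx (1 • 1)
    ⟨ℓ.1, by simp⟩ 1 (SetLike.pow_mem_graded 1 (X_mem_grading k n j))
  refine Eq.trans h ?_
  simp only [pow_one]

lemma awayRatio_mul_awayRatio (ℓ : grading k n 1) (i j : Fin (n + 1)) :
    awayMap (grading k n) (X_mem_grading k n i) rfl (awayRatio ℓ j) *
      awayMap (grading k n) (X_mem_grading k n j) (mul_comm _ _) (awayRatio (coordForm k n j) i) =
    awayMap (grading k n) (X_mem_grading k n j) (mul_comm (MvPolynomial.X j) (MvPolynomial.X i))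
      (awayRatio ℓ i) := by
  refine val_injective _ ?_
  rw [val_mul, val_awayMap_awayRatio, val_awayMap_awayRatio, val_awayMap_awayRatio,
    Localization.mk_mul, Localization.mk_eq_mk_iff, Localization.r_iff_exists]
  refine ⟨1, ?_⟩
  simp only [coordForm, Submonoid.coe_mul]
  ring

lemma evalHom_ratio_mul (p : Spec R ⟶ ProjSpace k n) (ℓ : grading k n 1) {i j : Fin (n + 1)}
    (hj : ⊤ ≤ p ⁻¹ᵁ chart k n j) (hi : ⊤ ≤ p ⁻¹ᵁ chart k n i) :
    evalHom p _ hj (ratio ℓ j) * evalHom p _ hi (ratio (coordForm k n j) i) =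
      evalHom p _ hi (ratio ℓ i) := by
  have hij : ⊤ ≤ p ⁻¹ᵁ Proj.basicOpen (grading k n) (MvPolynomial.X j * MvPolynomial.X i) := by
    rw [Proj.basicOpen_mul]
    exact le_inf hj hi
  obtain ⟨g, hg⟩ := exists_specMap_awayι_eq
    (SetLike.mul_mem_graded (X_mem_grading k n j) (X_mem_grading k n i)) two_pos hij
  have heval {a b : Fin (n + 1)} (hx : MvPolynomial.X j * MvPolynomial.X i = _)
      (ha : ⊤ ≤ p ⁻¹ᵁ chart k n a) (ℓ' : grading k n 1) :
      evalHom p _ ha (ratio ℓ' a) =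
        g (awayMap (grading k n) (X_mem_grading k n b) hx (awayRatio ℓ' a)) := by
    refine evalHom_awayToSection (g := g.comp (awayMap (grading k n) (X_mem_grading k n b) hx))
      (hf := X_mem_grading k n a) (hm := one_pos) ?_ ha _
    rw [← hg, CommRingCat.ofHom_comp, Spec.map_comp, Category.assoc, Proj.SpecMap_awayMap_awayι]
  rw [heval rfl hj, heval (mul_comm _ _) hi, heval (mul_comm _ _) hi, ← map_mul,
    awayRatio_mul_awayRatio]

lemma isUnit_evalHom_ratio_iff (p : Spec R ⟶ ProjSpace k n) {i : Fin (n + 1)}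
    (hi : ⊤ ≤ p ⁻¹ᵁ chart k n i) (j : Fin (n + 1)) :
    IsUnit (evalHom p _ hi (ratio (coordForm k n j) i)) ↔ ⊤ ≤ p ⁻¹ᵁ chart k n j := by
  obtain ⟨g, hg⟩ := exists_specMap_awayι_eq (X_mem_grading k n i) one_pos hi
  have helem : Away.isLocalizationElem (X_mem_grading k n i) (X_mem_grading k n j) =
      awayRatio (coordForm k n j) i := by
    refine val_injective _ ?_
    rw [val_awayRatio, Away.val_mk]
    congr 2 <;> simp [coordForm]
  have hpre : p ⁻¹ᵁ chart k n j = PrimeSpectrum.basicOpen (g (awayRatio (coordForm k n j) i)) := by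
    rw [← hg, Scheme.Hom.comp_preimage,
      Proj.awayι_preimage_basicOpen (grading k n) _ one_pos (X_mem_grading k n j) one_pos, helem]
    rfl
  have hval : evalHom p _ hi (ratio (coordForm k n j) i) = g (awayRatio (coordForm k n j) i) :=
    evalHom_awayToSection hg hi _
  have hspan := PrimeSpectrum.iSup_basicOpen_eq_top_iff' (s := {g (awayRatio (coordForm k n j) i)})
  rw [iSup_singleton, Ideal.span_singleton_eq_top] at hspan
  rw [hval, hpre]
  exact hspan.symm.trans top_le_iff.symm

lemma mk_prod_X_pow (j : Fin (n + 1)) (d : ℕ) (m : Fin (n + 1) → ℕ)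
    (hm : ∏ i, MvPolynomial.X i ^ m i ∈ grading k n (d • 1)) (hd : ∑ i, m i = d) :
    Away.mk (grading k n) (X_mem_grading k n j) d (∏ i, MvPolynomial.X i ^ m i) hm =
      ∏ i, awayRatio (coordForm k n i) j ^ m i := by
  refine val_injective _ ?_
  rw [← HomogeneousLocalization.algebraMap_apply (∏ i, _), map_prod]
  simp only [map_pow, HomogeneousLocalization.algebraMap_apply, val_awayRatio, Localization.mk_pow,
    Localization.mk_prod, Away.val_mk, coordForm]
  congr 1
  ext
  simp [Finset.prod_pow_eq_pow_sum, hd]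

lemma adjoin_awayRatio (j : Fin (n + 1)) :
    Algebra.adjoin (grading k n 0) (Set.range fun l => awayRatio (coordForm k n l) j) = ⊤ := by
  have hX : Algebra.adjoin (grading k n 0)
      (Set.range (MvPolynomial.X : Fin (n + 1) → MvPolynomial (Fin (n + 1)) k)) = ⊤ := by
    refine top_le_iff.1 fun q _ => ?_
    induction q using MvPolynomial.induction_on with
    | C a =>
      exact Subalgebra.algebraMap_mem _ (algebraMap k (grading k n 0) a)
    | add q r hq hr => exact add_mem (hq trivial) (hr trivial)
    | mul_X q i hq => exact mul_mem (hq trivial) (Algebra.subset_adjoin ⟨i, rfl⟩)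
  refine top_le_iff.1 ?_
  rw [← Away.adjoin_mk_prod_pow_eq_top (X_mem_grading k n j) _ MvPolynomial.X hX (fun _ => 1)
    (X_mem_grading k n), Algebra.adjoin_le_iff]
  rintro _ ⟨d, m, hm, -, rfl⟩
  rw [mk_prod_X_pow j d m _ (by simpa using hm)]
  exact prod_mem fun i _ => pow_mem (Algebra.subset_adjoin (Set.mem_range_self i)) _

lemma apply_fromZeroRingHom_of_comp_toSpec [Algebra k R] {p : Spec R ⟶ ProjSpace k n}
    (hpk : p ≫ ProjSpace.toSpec k n = Spec.map (CommRingCat.ofHom (algebraMap k R)))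
    {f : MvPolynomial (Fin (n + 1)) k} {m : ℕ} {hf : f ∈ grading k n m} {hm : 0 < m}
    {g : Away (grading k n) f →+* R}
    (hg : Spec.map (CommRingCat.ofHom g) ≫ Proj.awayι (grading k n) f hf hm = p) (c : k) :
    g (algebraMap (grading k n 0) _ (algebraMap k (grading k n 0) c)) = algebraMap k R c := by
  rw [← hg, ProjSpace.toSpec, Category.assoc, Proj.awayι_toSpecZero_assoc, ← Spec.map_comp,
    ← Spec.map_comp] at hpk
  exact congrArg (fun h => h.hom c) (Spec.map_injective hpk)

lemma algebraMap_grading_zero_surjective :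
    Function.Surjective (algebraMap k (grading k n 0)) := fun c => by
  have hc : (c : MvPolynomial (Fin (n + 1)) k).totalDegree = 0 :=
    (MvPolynomial.totalDegree_zero_iff_isHomogeneous _).2
      ((MvPolynomial.mem_homogeneousSubmodule _ _).1 c.2)
  exact ⟨_, Subtype.ext (MvPolynomial.totalDegree_eq_zero_iff_eq_C.1 hc).symm⟩

lemma range_evalHom_chart [Algebra k R] {p : Spec R ⟶ ProjSpace k n}
    (hpk : p ≫ ProjSpace.toSpec k n = Spec.map (CommRingCat.ofHom (algebraMap k R)))
    {j : Fin (n + 1)} (hj : ⊤ ≤ p ⁻¹ᵁ chart k n j) :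
    Set.range (evalHom p _ hj) =
      Algebra.adjoin k (Set.range fun l => evalHom p _ hj (ratio (coordForm k n l) j)) := by
  obtain ⟨g, hg⟩ := exists_specMap_awayι_eq (X_mem_grading k n j) one_pos hj
  have hval (a : Away (grading k n) (MvPolynomial.X j : MvPolynomial (Fin (n + 1)) k)) :
      evalHom p _ hj (Proj.awayToSection (grading k n) _ a) = g a :=
    evalHom_awayToSection hg hj a
  have hconst := apply_fromZeroRingHom_of_comp_toSpec hpk hg
  refine subset_antisymm ?_ fun y hy => ?_
  · rintro _ ⟨s, rfl⟩
    obtain ⟨a, rfl⟩ := (ConcreteCategory.bijective_of_isIso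
      (Proj.basicOpenIsoAway (grading k n) _ (X_mem_grading k n j) one_pos).hom).2 s
    refine (hval a).symm ▸ ?_
    have ha : a ∈ Algebra.adjoin (grading k n 0)
        (Set.range fun l => awayRatio (coordForm k n l) j) := by
      rw [adjoin_awayRatio j]
      exact Algebra.mem_top
    induction ha using Algebra.adjoin_induction with
    | mem _ h =>
      obtain ⟨l, rfl⟩ := h
      exact Algebra.subset_adjoin ⟨l, hval _⟩
    | algebraMap c =>
      obtain ⟨c, rfl⟩ := algebraMap_grading_zero_surjective c
      rw [hconst]
      exact Subalgebra.algebraMap_mem _ c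
    | add _ _ _ _ hx hy => rw [map_add]; exact add_mem hx hy
    | mul _ _ _ _ hx hy => rw [map_mul]; exact mul_mem hx hy
  · change y ∈ (evalHom p _ hj).range
    induction hy using Algebra.adjoin_induction with
    | mem _ h =>
      obtain ⟨l, rfl⟩ := h
      exact ⟨_, rfl⟩
    | algebraMap c => exact ⟨_, (hval _).trans (hconst c)⟩
    | add _ _ _ _ hx hy => exact add_mem hx hy
    | mul _ _ _ _ hx hy => exact mul_mem hx hy

end ProjectivePoints

section HomogeneousCoordinates

variable {k L : Type u} [Field k] [Field L] {n : ℕ}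

lemma homCoords_ne_zero_iff (p : Spec (.of L) ⟶ ProjSpace k n) (j : Fin (n + 1)) :
    homCoords p j ≠ 0 ↔ ⊤ ≤ p ⁻¹ᵁ chart k n j :=
  isUnit_iff_ne_zero.symm.trans (isUnit_evalHom_ratio_iff p (exists_chart p).choose_spec j)

lemma evalHom_ratio_mul_homCoords (p : Spec (.of L) ⟶ ProjSpace k n) (l : Fin (n + 1))
    {j : Fin (n + 1)} (hj : ⊤ ≤ p ⁻¹ᵁ chart k n j) :
    evalHom p _ hj (ratio (coordForm k n l) j) * homCoords p j = homCoords p l :=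
  evalHom_ratio_mul p (coordForm k n l) hj (exists_chart p).choose_spec

lemma exists_forall_evalHom_ratio_mul_homCoords_eq (p : Spec (.of L) ⟶ ProjSpace k n)
    (ℓ : grading k n 1) :
    ∃ a, ∀ (j) (hj : ⊤ ≤ p ⁻¹ᵁ chart k n j), evalHom p _ hj (ratio ℓ j) * homCoords p j = a := by
  have h₀ := (exists_chart p).choose_spec
  refine ⟨evalHom p _ h₀ (ratio ℓ _), fun j hj => evalHom_ratio_mul p ℓ hj h₀⟩

lemma exists_mem_preimage_chart {V : Scheme.{u}} (φ : V ⟶ ProjSpace k n) (x : V) :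
    ∃ j, x ∈ φ ⁻¹ᵁ chart k n j := by
  have hx : φ x ∈ ⨆ j, chart k n j := by rw [iSup_chart]; trivial
  exact (TopologicalSpace.Opens.mem_iSup (x := φ x)).1 hx

end HomogeneousCoordinates

/-! ### Rational functions and local rings -/

section FunctionField

lemma genericPoint_mem {V : Scheme.{u}} [IrreducibleSpace V] {U : V.Opens} {x : V} (hx : x ∈ U) :
    genericPoint V ∈ U :=
  ((genericPoint_spec V).specializes trivial).mem_open U.2 hx

variable {k : Type u} [Field k] {V : Scheme.{u}} [IsIntegral V] (π : V ⟶ Spec (.of k)) {n : ℕ}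

/-- The function field of the `k`-scheme `π : V ⟶ Spec k`; recording `π` in the type lets it carry
its structure of `k`-algebra. -/
def FunctionField (_ : V ⟶ Spec (.of k)) : Type u := V.functionField

instance : Field (FunctionField π) := inferInstanceAs (Field V.functionField)

instance : Algebra k (FunctionField π) :=
  (Spec.preimage (V.fromSpecStalk (genericPoint V) ≫ π)).hom.toAlgebra

/-- The embedding of the local ring at `x` in the function field. -/
def stalkHom (x : V) : V.presheaf.stalk x →+* FunctionField π :=
  algebraMap (V.presheaf.stalk x) V.functionField

lemma stalkHom_injective (x : V) : Function.Injective (stalkHom π x) :=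
  IsFractionRing.injective (V.presheaf.stalk x) V.functionField

lemma stalkHom_preimage (x : V) (c : k) :
    stalkHom π x (Spec.preimage (V.fromSpecStalk x ≫ π) c) = algebraMap k (FunctionField π) c := by
  have h : Spec.preimage (V.fromSpecStalk x ≫ π) ≫ V.presheaf.stalkSpecializes
      ((genericPoint_spec V).specializes trivial) =
      Spec.preimage (V.fromSpecStalk (genericPoint V) ≫ π) := by
    refine Spec.map_injective ?_
    rw [Spec.map_comp, Spec.map_preimage, Spec.map_preimage,
      Scheme.SpecMap_stalkSpecializes_fromSpecStalk_assoc]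
  exact congrArg (fun f => f.hom c) h

/-- The local ring `𝒪_{V,x}` as a subalgebra of the function field. -/
def localRing (x : V) : Subalgebra k (FunctionField π) where
  toSubsemiring := (stalkHom π x).rangeS
  algebraMap_mem' c := ⟨_, stalkHom_preimage π x c⟩

lemma stalkHom_mem_localRing (x : V) (s : V.presheaf.stalk x) : stalkHom π x s ∈ localRing π x :=
  ⟨s, rfl⟩

lemma exists_algHom_localRing {L : Type u} [Field L] [Algebra k L] (x : V)
    (g : V.presheaf.stalk x ⟶ .of L) (hg : Spec.map g ≫ V.fromSpecStalk x ≫ π =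
      Spec.map (CommRingCat.ofHom (algebraMap k L))) :
    ∃ ev : localRing π x →ₐ[k] L, ∀ s, ev ⟨stalkHom π x s, s, rfl⟩ = g s := by
  let e : V.presheaf.stalk x ≃+* (stalkHom π x).range :=
    RingEquiv.ofLeftInverse (Function.leftInverse_invFun (stalkHom_injective π x))
  have he (s : V.presheaf.stalk x) {z : (stalkHom π x).range} (hz : stalkHom π x s = z) :
      e.symm z = s :=
    e.symm_apply_eq.2 (Subtype.ext hz.symm)
  refine ⟨{ toRingHom := g.hom.comp e.symm.toRingHom, commutes' := fun c => ?_ }, fun s =>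
    congrArg g (he s rfl)⟩
  have h : Spec.preimage (V.fromSpecStalk x ≫ π) ≫ g = CommRingCat.ofHom (algebraMap k L) :=
    Spec.map_injective (by rw [Spec.map_comp, Spec.map_preimage, hg])
  exact (congrArg g (he _ (stalkHom_preimage π x c))).trans (congrArg (fun f => f.hom c) h)

/-- The generic point of `V`, as a point with values in the function field. -/
def genericHom : Spec (.of (FunctionField π)) ⟶ V := V.fromSpecStalk (genericPoint V)

lemma top_le_genericHom_preimage_iff {U : V.Opens} :
    ⊤ ≤ genericHom π ⁻¹ᵁ U ↔ genericPoint V ∈ U := by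
  refine ⟨fun h => ?_, top_le_fromSpecStalk_preimage⟩
  have hU : V.fromSpecStalk (genericPoint V) (IsLocalRing.closedPoint _) ∈ U :=
    h (Set.mem_univ (IsLocalRing.closedPoint (V.presheaf.stalk (genericPoint V))))
  rwa [Scheme.fromSpecStalk_closedPoint] at hU

lemma evalHom_genericHom {U : V.Opens} {x : V} (hx : x ∈ U) (h : ⊤ ≤ genericHom π ⁻¹ᵁ U)
    (s : Γ(V, U)) :
    evalHom (genericHom π) U h s = stalkHom π x (V.presheaf.germ U x hx s) := by
  have hgen : genericPoint V ⤳ x := (genericPoint_spec V).specializes trivial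
  rw [← evalHom_fromSpecStalk hx]
  exact evalHom_of_specMap_comp_eq (Scheme.SpecMap_stalkSpecializes_fromSpecStalk hgen) _ h s

/-- Homogeneous coordinates of `φ` at the generic point: a tuple of rational functions. -/
def coords (φ : V ⟶ ProjSpace k n) : Fin (n + 1) → FunctionField π := homCoords (genericHom π ≫ φ)

/-- The germ at `x` of the regular function `φ^*(ℓ / Xⱼ)`. -/
def ratioGerm (φ : V ⟶ ProjSpace k n) (ℓ : grading k n 1) {j : Fin (n + 1)} {x : V}
    (hx : x ∈ φ ⁻¹ᵁ chart k n j) : V.presheaf.stalk x :=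
  V.presheaf.germ (φ ⁻¹ᵁ chart k n j) x hx (φ.app (chart k n j) (ratio ℓ j))

variable {π} {φ : V ⟶ ProjSpace k n}

lemma coords_ne_zero_iff (j : Fin (n + 1)) :
    coords π φ j ≠ 0 ↔ genericPoint V ∈ φ ⁻¹ᵁ chart k n j :=
  (homCoords_ne_zero_iff _ j).trans (top_le_genericHom_preimage_iff π (U := φ ⁻¹ᵁ chart k n j))

lemma evalHom_ratio_eq_stalkHom_ratioGerm (ℓ : grading k n 1) {j : Fin (n + 1)} {x : V}
    (hx : x ∈ φ ⁻¹ᵁ chart k n j) (h : ⊤ ≤ (genericHom π ≫ φ) ⁻¹ᵁ chart k n j) :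
    evalHom (genericHom π ≫ φ) _ h (ratio ℓ j) = stalkHom π x (ratioGerm φ ℓ hx) :=
  (evalHom_comp _ _ _ h _).trans (evalHom_genericHom π hx h _)

lemma stalkHom_ratioGerm_mul_coords (l : Fin (n + 1)) {j : Fin (n + 1)} {x : V}
    (hx : x ∈ φ ⁻¹ᵁ chart k n j) :
    stalkHom π x (ratioGerm φ (coordForm k n l) hx) * coords π φ j = coords π φ l := by
  have h : ⊤ ≤ (genericHom π ≫ φ) ⁻¹ᵁ chart k n j :=
    (top_le_genericHom_preimage_iff π).2 (genericPoint_mem hx)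
  have heval := evalHom_ratio_eq_stalkHom_ratioGerm (π := π) (coordForm k n l) hx h
  have := evalHom_ratio_mul_homCoords (genericHom π ≫ φ) l h
  rw [heval] at this
  exact this

lemma exists_forall_stalkHom_ratioGerm_mul_coords_eq (ℓ : grading k n 1) :
    ∃ a, ∀ (j : Fin (n + 1)) (x : V) (hx : x ∈ φ ⁻¹ᵁ chart k n j),
      stalkHom π x (ratioGerm φ ℓ hx) * coords π φ j = a := by
  obtain ⟨a, ha⟩ := exists_forall_evalHom_ratio_mul_homCoords_eq (genericHom π ≫ φ) ℓ
  refine ⟨a, fun j x hx => ?_⟩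
  have h : ⊤ ≤ (genericHom π ≫ φ) ⁻¹ᵁ chart k n j :=
    (top_le_genericHom_preimage_iff π).2 (genericPoint_mem hx)
  have heval := evalHom_ratio_eq_stalkHom_ratioGerm (π := π) ℓ hx h
  exact heval ▸ ha j h

lemma dominates_coords {j : Fin (n + 1)} {x : V} (hx : x ∈ φ ⁻¹ᵁ chart k n j) :
    Dominates (localRing π x) (coords π φ) j := by
  have hj : coords π φ j ≠ 0 := (coords_ne_zero_iff j).2 (genericPoint_mem hx)
  refine ⟨hj, fun l => ?_⟩
  rw [← stalkHom_ratioGerm_mul_coords l hx, mul_div_cancel_right₀ _ hj]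
  exact stalkHom_mem_localRing π x _

lemma isBasePointFree_coords (φ : V ⟶ ProjSpace k n) :
    IsBasePointFree (localRing π) (coords π φ) := fun x =>
  (exists_mem_preimage_chart φ x).imp fun _ => dominates_coords

lemma genericHom_comp : genericHom π ≫ π =
    Spec.map (CommRingCat.ofHom (algebraMap k (FunctionField π))) :=
  (Spec.map_preimage _).symm

lemma exists_germ_mul_eq_germ {X : Scheme.{u}} {U : X.Opens} (hU : IsAffineOpen U)
    (𝔮 : Ideal Γ(X, U)) [h𝔮 : 𝔮.IsPrime] : ∃ (x : X) (hx : x ∈ U),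
      (∀ t ∉ 𝔮, IsUnit (X.presheaf.germ U x hx t)) ∧
      ∀ z, ∃ s, ∃ t ∉ 𝔮, z * X.presheaf.germ U x hx t = X.presheaf.germ U x hx s := by
  let y : PrimeSpectrum Γ(X, U) := ⟨𝔮, h𝔮⟩
  have hx : hU.fromSpec y ∈ U := (hU.isoSpec.inv y).2
  algebraize [(X.presheaf.germ U _ hx).hom]
  have hloc : IsLocalization 𝔮.primeCompl (X.presheaf.stalk (hU.fromSpec y)) :=
    hU.isLocalization_stalk' y hx
  refine ⟨hU.fromSpec y, hx, fun t ht => ?_, fun z => ?_⟩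
  · exact IsLocalization.map_units _ (⟨t, ht⟩ : 𝔮.primeCompl)
  obtain ⟨⟨s, t⟩, hst⟩ := IsLocalization.surj 𝔮.primeCompl z
  exact ⟨s, t, t.2, hst⟩

lemma exists_isLocalizationAt_localRing {U : V.Opens} (hU : IsAffineOpen U)
    (h : ⊤ ≤ genericHom π ⁻¹ᵁ U) {S : Subalgebra k (FunctionField π)}
    (hS : Set.range (evalHom (genericHom π) U h) = S) (𝔭 : Ideal S) [h𝔭 : 𝔭.IsPrime] :
    ∃ x, IsLocalizationAt S (localRing π x) 𝔭 := by
  let r : Γ(V, U) →+* S := (evalHom (genericHom π) U h).codRestrict S fun s =>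
    hS.subset (Set.mem_range_self s)
  have hr : Function.Surjective r := fun a => by
    obtain ⟨s, hs⟩ : (a : FunctionField π) ∈ Set.range (evalHom (genericHom π) U h) :=
      hS.superset a.2
    exact ⟨s, Subtype.ext hs⟩
  obtain ⟨x, hx, hunit, hfrac⟩ := exists_germ_mul_eq_germ hU (𝔭.comap r)
  have hgerm (s : Γ(V, U)) : stalkHom π x (V.presheaf.germ U x hx s) = r s :=
    (evalHom_genericHom π hx h s).symm
  refine ⟨x, fun g => ⟨?_, ?_⟩⟩
  · rintro ⟨z, rfl⟩
    obtain ⟨s, t, ht, hst⟩ := hfrac z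
    refine ⟨r s, r t, ht, ?_⟩
    rw [eq_div_iff (coe_ne_zero_of_notMem ht), ← hgerm, ← hgerm, ← hst, map_mul]
  · rintro ⟨a, b, hb, rfl⟩
    obtain ⟨s, rfl⟩ := hr a
    obtain ⟨t, rfl⟩ := hr b
    obtain ⟨w, hw⟩ := (hunit t hb).exists_left_inv
    rw [← hgerm, ← hgerm]
    refine ⟨V.presheaf.germ U x hx s * w, eq_div_of_mul_eq ?_ ?_⟩
    · rw [hgerm]
      exact coe_ne_zero_of_notMem hb
    · rw [← map_mul, mul_assoc, hw, mul_one]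

lemma isEmbedding_coords (hφ : φ ≫ ProjSpace.toSpec k n = π) [IsClosedImmersion φ] :
    IsEmbedding (localRing π) (coords π φ) := fun q hq 𝔭 _ => by
  have h : ⊤ ≤ (genericHom π ≫ φ) ⁻¹ᵁ chart k n q := (homCoords_ne_zero_iff _ q).1 hq
  have haff : IsAffineOpen (chart k n q) :=
    Proj.isAffineOpen_basicOpen _ _ (X_mem_grading k n q) one_pos
  refine exists_isLocalizationAt_localRing (haff.preimage φ) h ?_ 𝔭
  have hover : (genericHom π ≫ φ) ≫ ProjSpace.toSpec k n =
      Spec.map (CommRingCat.ofHom (algebraMap k (FunctionField π))) := by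
    rw [Category.assoc, hφ, genericHom_comp]
  have hratio (l) : evalHom (genericHom π ≫ φ) _ h (ratio (coordForm k n l) q) =
      coords π φ l / coords π φ q :=
    eq_div_of_mul_eq hq (evalHom_ratio_mul_homCoords _ l h)
  have hrange : Set.range (evalHom (genericHom π) (φ ⁻¹ᵁ chart k n q) h) =
      Set.range (evalHom (genericHom π ≫ φ) _ h) := by
    rw [← (φ.app_surjective _ haff).range_comp]
    exact congrArg Set.range (funext fun s => (evalHom_comp _ φ _ h s).symm)
  refine hrange.trans ((range_evalHom_chart hover h).trans ?_)
  simp only [hratio, chartAlgebra]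

variable [CharZero k] [Algebra.IsAlgebraic ℚ k]

instance charZero_algebraicClosure : CharZero (AlgebraicClosure k) :=
  charZero_of_injective_algebraMap (algebraMap k (AlgebraicClosure k)).injective

instance isAlgebraic_rat_algebraicClosure : Algebra.IsAlgebraic ℚ (AlgebraicClosure k) :=
  Algebra.IsAlgebraic.trans ℚ k (AlgebraicClosure k)

lemma exists_mapHeight_eq_heightAt (P : GeomPoint π) :
    ∃ (x : V) (ev : localRing π x →ₐ[k] AlgebraicClosure k),
      ∀ (n : ℕ) (φ : V ⟶ ProjSpace k n), mapHeight φ P = heightAt ev (coords π φ) := by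
  obtain ⟨p, hp⟩ := P
  let x : V := p (IsLocalRing.closedPoint _)
  have hspec : Spec.map (Scheme.stalkClosedPointTo p) ≫ V.fromSpecStalk x = p :=
    Scheme.Spec_stalkClosedPointTo_fromSpecStalk p
  obtain ⟨ev, hev⟩ := exists_algHom_localRing π x (Scheme.stalkClosedPointTo p)
    (by rw [reassoc_of% hspec]; exact hp)
  refine ⟨x, ev, fun n φ => ?_⟩
  obtain ⟨j, hj⟩ := exists_mem_preimage_chart φ x
  have hpj : ⊤ ≤ (p ≫ φ) ⁻¹ᵁ chart k n j := (Scheme.preimage_eq_top_of_closedPoint_mem _ hj).ge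
  have hf := dominates_coords (π := π) hj
  have hval (l) : ev (hf.normalize l) * homCoords (p ≫ φ) j = homCoords (p ≫ φ) l := by
    have hnorm : hf.normalize l =
        ⟨_, stalkHom_mem_localRing π x (ratioGerm φ (coordForm k n l) hj)⟩ :=
      Subtype.ext ((div_eq_iff hf.1).2 (stalkHom_ratioGerm_mul_coords l hj).symm)
    have heval : evalHom (p ≫ φ) _ hpj (ratio (coordForm k n l) j) =
        Scheme.stalkClosedPointTo p (ratioGerm φ (coordForm k n l) hj) :=
      (evalHom_comp p φ _ hpj _).trans ((evalHom_of_specMap_comp_eq hspec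
        (top_le_fromSpecStalk_preimage hj) hpj _).trans
          (congrArg (Scheme.stalkClosedPointTo p) (evalHom_fromSpecStalk hj _)))
    rw [hnorm, hev, ← heval, evalHom_ratio_mul_homCoords]
  have hj0 : homCoords (p ≫ φ) j ≠ 0 := (homCoords_ne_zero_iff _ j).2 hpj
  have hsmul : homCoords (p ≫ φ) = homCoords (p ≫ φ) j • fun l => ev (hf.normalize l) :=
    funext fun l => (hval l).symm.trans (mul_comm _ _)
  rw [hf.heightAt_eq]
  exact (congrArg absLogHeight hsmul).trans (absLogHeight_smul _ hj0)

end FunctionField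

/-! ### Divisor classes and tuples of rational functions -/

section PullbackClasses

open Divisor

variable {k : Type u} [Field k] {V : Scheme.{u}} [IsIntegral V] {π : V ⟶ Spec (.of k)} {n : ℕ}
  {D E : Divisor V} {x : V} {f g : V.functionFieldˣ} {ι κ : Type*}

lemma Divisor.isLocalEquation_principal (x : V) (f : V.functionFieldˣ) :
    (principal f).IsLocalEquation x f := rfl

lemma Divisor.IsLocalEquation.add (hf : D.IsLocalEquation x f) (hg : E.IsLocalEquation x g) :
    (D + E).IsLocalEquation x (f * g) :=
  (congrArg₂ (· * ·) hf hg : D.toMul.1 x * E.toMul.1 x = QuotientGroup.mk f * QuotientGroup.mk g)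

lemma Divisor.IsLocalEquation.nsmul (hf : D.IsLocalEquation x f) (m : ℕ) :
    (m • D).IsLocalEquation x (f ^ m) :=
  (congrArg (· ^ m) hf : D.toMul.1 x ^ m = QuotientGroup.mk f ^ m)

lemma Divisor.IsLocalEquation.exists_stalk_eq_div (hf : D.IsLocalEquation x f)
    (hg : D.IsLocalEquation x g) :
    ∃ s, algebraMap (V.presheaf.stalk x) V.functionField s = (g : V.functionField) / f := by
  obtain ⟨s, hs⟩ := QuotientGroup.eq.1 (hf.symm.trans hg)
  refine ⟨s, ?_⟩
  rw [div_eq_inv_mul, ← Units.val_inv_eq_inv_val, ← Units.val_mul]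
  exact congrArg Units.val hs

/-- `D` is linearly equivalent to the pullbacks of hyperplanes under the map with homogeneous
coordinates `f`: up to a factor not depending on the point, the inverse of an entry of `f`
dominating at `x` is a local equation of `D` at `x`. -/
def Divisor.IsPullbackClass (D : Divisor V) (f : ι → FunctionField π) : Prop :=
  ∃ c : FunctionField π, c ≠ 0 ∧ ∀ x, ∃ j, Dominates (localRing π x) f j ∧
    ∃ u : (FunctionField π)ˣ, D.IsLocalEquation x u ∧ u * f j = c

lemma Divisor.IsPullbackClass.isBasePointFree {f : ι → FunctionField π}
    (hf : D.IsPullbackClass f) : IsBasePointFree (localRing π) f :=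
  have ⟨_, _, h⟩ := hf
  fun x => (h x).imp fun _ => And.left

lemma Divisor.IsPullbackClass.add {f : ι → FunctionField π} {g : κ → FunctionField π}
    (hf : D.IsPullbackClass f) (hg : E.IsPullbackClass g) :
    (D + E).IsPullbackClass (segre f g) := by
  obtain ⟨c, hc, hf⟩ := hf
  obtain ⟨d, hd, hg⟩ := hg
  refine ⟨c * d, mul_ne_zero hc hd, fun x => ?_⟩
  obtain ⟨j, hj, u, hu, rfl⟩ := hf x
  obtain ⟨l, hl, v, hv, rfl⟩ := hg x
  refine ⟨(j, l), hj.segre hl, u * v, hu.add hv, ?_⟩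
  rw [segre, Units.val_mul, mul_mul_mul_comm]

lemma Divisor.IsPullbackClass.nsmul {f : ι → FunctionField π} (hf : D.IsPullbackClass f) (m : ℕ) :
    (m • D).IsPullbackClass (tensorPow f m) := by
  obtain ⟨c, hc, hf⟩ := hf
  refine ⟨c ^ m, pow_ne_zero m hc, fun x => ?_⟩
  obtain ⟨j, hj, u, hu, rfl⟩ := hf x
  refine ⟨_, hj.tensorPow m, u ^ m, hu.nsmul m, ?_⟩
  rw [tensorPow, Fin.prod_const, Units.val_pow_eq_pow_val, mul_pow]

lemma Divisor.IsPullbackClass.of_linEquiv {f : ι → FunctionField π} (hf : E.IsPullbackClass f)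
    (h : D.LinEquiv E) : D.IsPullbackClass f := by
  obtain ⟨c, hc, hf⟩ := hf
  obtain ⟨g, hg⟩ := h
  let g' : (FunctionField π)ˣ := g
  refine ⟨g' * c, mul_ne_zero g'.ne_zero hc, fun x => ?_⟩
  obtain ⟨j, hj, u, hu, rfl⟩ := hf x
  refine ⟨j, hj, g' * u, ?_, by rw [Units.val_mul, mul_assoc]⟩
  exact sub_add_cancel D E ▸ hg ▸ (isLocalEquation_principal x g).add hu

lemma IsHyperplanePullback.isPullbackClass {φ : V ⟶ ProjSpace k n} {ℓ : grading k n 1}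
    (h : IsHyperplanePullback φ ℓ D) : D.IsPullbackClass (coords π φ) := by
  obtain ⟨c, hc⟩ := exists_forall_stalkHom_ratioGerm_mul_coords_eq (π := π) (φ := φ) ℓ
  have hloc (x : V) : ∃ j, Dominates (localRing π x) (coords π φ) j ∧
      ∃ u : (FunctionField π)ˣ, D.IsLocalEquation x u ∧ u * coords π φ j = c := by
    obtain ⟨j, hj⟩ := exists_mem_preimage_chart φ x
    obtain ⟨u, hu, hD⟩ := h j x hj
    exact ⟨j, dominates_coords hj, u, hD, (congrArg (· * coords π φ j) hu).trans (hc j x hj)⟩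
  obtain ⟨j, hj, u, -, hu⟩ := hloc (genericPoint V)
  exact ⟨c, hu ▸ mul_ne_zero u.ne_zero hj.1, hloc⟩

lemma IsHyperplaneClass.isPullbackClass {φ : V ⟶ ProjSpace k n} (h : IsHyperplaneClass φ D) :
    D.IsPullbackClass (coords π φ) :=
  have ⟨_, _, hA, hDA⟩ := h
  hA.isPullbackClass.of_linEquiv hDA

lemma Divisor.IsPullbackClass.exists_forall_div_mem {f : ι → FunctionField π}
    {g : κ → FunctionField π} (hf : D.IsPullbackClass f) (hg : D.IsPullbackClass g) :
    ∃ c : FunctionField π, c ≠ 0 ∧ ∀ x j l, Dominates (localRing π x) (c • f) j →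
      Dominates (localRing π x) g l →
        g l / (c • f) j ∈ localRing π x ∧ (c • f) j / g l ∈ localRing π x := by
  obtain ⟨c, hc, hf⟩ := hf
  obtain ⟨d, hd, hg⟩ := hg
  have hdc : d / c ≠ 0 := div_ne_zero hd hc
  refine ⟨d / c, hdc, fun x j l hj hl => ?_⟩
  obtain ⟨i, hi, u, hu, rfl⟩ := hf x
  obtain ⟨a, ha, v, hv, rfl⟩ := hg x
  have hi' := hi.smul hdc
  have hquot : (v : FunctionField π) * g a / (u * f i) * f i = v / u * g a := by
    have := hi.1
    field_simp
  have huv : (v / u : FunctionField π) ∈ localRing π x := hu.exists_stalk_eq_div hv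
  have hvu : (u / v : FunctionField π) ∈ localRing π x := hv.exists_stalk_eq_div hu
  refine ⟨hj.div_mem ha hi'.1 ?_ l, hl.div_mem hi' ha.1 ?_ j⟩ <;>
    rw [Pi.smul_apply, smul_eq_mul, hquot]
  · rwa [div_mul_cancel_right₀ ha.1, inv_div]
  · rwa [mul_div_cancel_right₀ _ ha.1]

lemma Divisor.IsPullbackClass.exists_heightAt_le_add {L : Type*} [Field L] [CharZero L]
    [Algebra.IsAlgebraic ℚ L] [Algebra k L] [Finite ι] [Finite κ] {f : ι → FunctionField π}
    {g : κ → FunctionField π} (hf : D.IsPullbackClass f) (hg : D.IsPullbackClass g)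
    (hge : IsEmbedding (localRing π) g) :
    ∃ C, ∀ (x : V) (ev : localRing π x →ₐ[k] L), heightAt ev g ≤ heightAt ev f + C := by
  obtain ⟨c, hc, hdiv⟩ := hf.exists_forall_div_mem hg
  have hcf : IsBasePointFree (localRing π) (c • f) := fun x =>
    (hf.isBasePointFree x).imp fun _ hj => hj.smul hc
  obtain ⟨C, hC⟩ := HeightRatio.exists_heightAt_le_add (L := L) hcf hg.isBasePointFree hge
    (fun x j l hj hl => (hdiv x j l hj hl).1) fun x j l hj hl => (hdiv x j l hj hl).2
  refine ⟨C, fun x ev => ?_⟩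
  obtain ⟨j, hj⟩ := hf.isBasePointFree x
  rw [← hj.heightAt_smul ev hc]
  exact hC x ev

end PullbackClasses

/-! ### Weil heights -/

section Weil

variable {k : Type u} [Field k] [CharZero k] [Algebra.IsAlgebraic ℚ k] {V : Scheme.{u}}
  {π : V ⟶ Spec (.of k)} {n r s : ℕ}

lemma mapHeight_nonneg (φ : V ⟶ ProjSpace k n) (P : GeomPoint π) : 0 ≤ mapHeight φ P :=
  absLogHeight_nonneg _

variable [IsIntegral V] {D E : Divisor V}

lemma exists_mul_mapHeight_add_le {A B : Divisor V} {φ : V ⟶ ProjSpace k n}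
    {ψ : V ⟶ ProjSpace k s} {i : V ⟶ ProjSpace k r} [IsClosedImmersion i]
    (hi : i ≫ ProjSpace.toSpec k r = π) (hA : IsHyperplaneClass φ A)
    (hB : IsHyperplaneClass ψ B) (hE : IsHyperplaneClass i E) {m : ℕ}
    (hAB : (m • A).LinEquiv (m • B + E)) :
    ∃ C, ∀ P : GeomPoint π, m * mapHeight ψ P + mapHeight i P ≤ m * mapHeight φ P + C := by
  have hA' := (hA.isPullbackClass (π := π)).nsmul m
  have hBE := (hB.isPullbackClass.nsmul m).add (hE.isPullbackClass (π := π))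
  have hemb := (isEmbedding_coords hi).segre (hB.isPullbackClass.nsmul m).isBasePointFree
  obtain ⟨C, hC⟩ := hA'.exists_heightAt_le_add (L := AlgebraicClosure k) (hBE.of_linEquiv hAB) hemb
  refine ⟨C, fun P => ?_⟩
  obtain ⟨x, ev, hev⟩ := exists_mapHeight_eq_heightAt P
  obtain ⟨a, ha⟩ := isBasePointFree_coords (π := π) φ x
  obtain ⟨b, hb⟩ := isBasePointFree_coords (π := π) ψ x
  obtain ⟨c, hc⟩ := isBasePointFree_coords (π := π) i x
  have h := hC x ev
  rw [(hb.tensorPow m).heightAt_segre ev hc, hb.heightAt_tensorPow, ha.heightAt_tensorPow] at h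
  simpa only [hev] using h

lemma nsmul_sub_nsmul_add_nsmul {G : Type*} [AddCommGroup G] (m : ℕ) (a b d : G) :
    m • a - (m • b + m • d) = -(m • (d - (a - b))) := by
  module

lemma Divisor.LinEquiv.nsmul_linEquiv_nsmul_add {A B : Divisor V} (h : D.LinEquiv (A - B))
    (m : ℕ) : (m • A).LinEquiv (m • B + m • D) := by
  obtain ⟨g, hg⟩ := h
  exact ⟨(g ^ m)⁻¹, (nsmul_sub_nsmul_add_nsmul m A B D).trans (congrArg (-(m • ·)) hg)⟩

lemma exists_mapHeight_le_of_isAmple {h : GeomPoint π → ℝ} (hD : IsAmple π D)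
    (hh : IsWeilHeight π D h) :
    ∃ (r : ℕ) (i : V ⟶ ProjSpace k r) (m : ℕ) (C : ℝ), i ≫ ProjSpace.toSpec k r = π ∧
      IsClosedImmersion i ∧ ∀ P, mapHeight i P ≤ m * h P + C := by
  obtain ⟨m, -, r, i, hi, hcl, hDi⟩ := hD
  obtain ⟨n, s, φ, ψ, A, B, -, -, hA, hB, hDAB, C', hC'⟩ := hh
  obtain ⟨C, hC⟩ := exists_mul_mapHeight_add_le hi hA hB hDi (hDAB.nsmul_linEquiv_nsmul_add m)
  refine ⟨r, i, m, C + m * C', hi, hcl, fun P => ?_⟩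
  have hm := mul_le_mul_of_nonneg_left (abs_le.1 (hC' P)).1 (Nat.cast_nonneg (α := ℝ) m)
  linarith [hC P]

lemma exists_mapHeight_le (i : V ⟶ ProjSpace k r) [IsClosedImmersion i]
    (hi : i ≫ ProjSpace.toSpec k r = π) (φ : V ⟶ ProjSpace k n) :
    ∃ C, 0 ≤ C ∧ ∀ P : GeomPoint π, mapHeight φ P ≤ C * mapHeight i P + C := by
  obtain ⟨C, hC0, hC⟩ := (isEmbedding_coords hi).exists_heightAt_le (L := AlgebraicClosure k)
    (isBasePointFree_coords i) (isBasePointFree_coords φ)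
  refine ⟨C, hC0, fun P => ?_⟩
  obtain ⟨x, ev, hev⟩ := exists_mapHeight_eq_heightAt P
  simpa only [hev] using hC x ev

lemma exists_abs_le_mapHeight {h : GeomPoint π → ℝ} (hh : IsWeilHeight π E h)
    (i : V ⟶ ProjSpace k r) [IsClosedImmersion i] (hi : i ≫ ProjSpace.toSpec k r = π) :
    ∃ a b, 0 ≤ a ∧ ∀ P, |h P| ≤ a * mapHeight i P + b := by
  obtain ⟨n, s, φ, ψ, -, -, -, -, -, -, -, C, hC⟩ := hh
  obtain ⟨a, ha, hφ⟩ := exists_mapHeight_le i hi φ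
  obtain ⟨b, hb, hψ⟩ := exists_mapHeight_le i hi ψ
  refine ⟨a + b, C + a + b, add_nonneg ha hb, fun P => ?_⟩
  obtain ⟨hlower, hupper⟩ := abs_le.1 (hC P)
  rw [abs_le]
  constructor <;> linarith [hφ P, hψ P, mapHeight_nonneg φ P, mapHeight_nonneg ψ P]

lemma exists_abs_le_of_isAmple {hD hE : GeomPoint π → ℝ} (hA : IsAmple π D)
    (hhD : IsWeilHeight π D hD) (hhE : IsWeilHeight π E hE) :
    ∃ a b, 0 ≤ a ∧ 0 ≤ b ∧ ∀ P, |hE P| ≤ a * hD P + b := by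
  obtain ⟨r, i, m, C, hi, _, hiD⟩ := exists_mapHeight_le_of_isAmple hA hhD
  obtain ⟨a, b, ha, hEi⟩ := exists_abs_le_mapHeight hhE i hi
  refine ⟨a * m, |a * C + b|, by positivity, abs_nonneg _, fun P => ?_⟩
  linarith [hEi P, mul_le_mul_of_nonneg_left (hiD P) ha, le_abs_self (a * C + b)]

end Weil

/-! ### Upper and lower limits of ratios -/

section Limits

open Filter

variable {α : Type*} {f g : α → ℝ} {a b : ℝ}

lemma eventually_le_comap_atTop (g : α → ℝ) (c : ℝ) : ∀ᶠ x in comap g atTop, c ≤ g x :=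
  (eventually_ge_atTop c).comap g

lemma limsup_abs_div_lt_top (hb : 0 ≤ b) (h : ∀ x, |f x| ≤ a * g x + b) :
    limsup (fun x => ((|f x / g x| : ℝ) : EReal)) (comap g atTop) < ⊤ := by
  refine (limsup_le_of_le (a := ((a + b : ℝ) : EReal)) (by isBoundedDefault) ?_).trans_lt
    (EReal.coe_lt_top _)
  filter_upwards [eventually_le_comap_atTop g 1] with x hx
  rw [EReal.coe_le_coe_iff, abs_div, abs_of_pos (zero_lt_one.trans_le hx),
    div_le_iff₀ (zero_lt_one.trans_le hx)]
  nlinarith [h x]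

lemma liminf_div_pos (ha : 0 ≤ a) (h : ∀ x, g x ≤ a * f x + b) :
    0 < liminf (fun x => ((f x / g x : ℝ) : EReal)) (comap g atTop) := by
  have hc : (0 : ℝ) < (2 * (a + 1))⁻¹ := by positivity
  refine (EReal.coe_pos.2 hc).trans_le (le_liminf_of_le (by isBoundedDefault) ?_)
  filter_upwards [eventually_le_comap_atTop g 1, eventually_le_comap_atTop g (2 * b)] with x h1 h2
  have hx := h x
  have hf : 0 ≤ f x := by
    by_contra! hf
    nlinarith [mul_nonpos_of_nonneg_of_nonpos ha hf.le]
  rw [EReal.coe_le_coe_iff, le_div_iff₀ (zero_lt_one.trans_le h1), inv_mul_le_iff₀ (by positivity)]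
  linarith

end Limits

end HeightRatio

end

theorem mainTheorem6 {k : Type u} [Field k] [CharZero k] [Algebra.IsAlgebraic ℚ k]
    (V : Scheme.{u}) [IsIntegral V] (π : V ⟶ Spec (.of k)) (hV : IsProjective π) :
    (∀ (D₁ D₂ : Divisor V) (h₁ h₂ : GeomPoint π → ℝ),
      IsAmple π D₁ → IsAmple π D₂ → IsWeilHeight π D₁ h₁ → IsWeilHeight π D₂ h₂ →
        0 < liminf (fun P => ((h₁ P / h₂ P : ℝ) : EReal)) (comap h₂ atTop) ∧
        limsup (fun P => ((h₁ P / h₂ P : ℝ) : EReal)) (comap h₂ atTop) < ⊤ ∧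
        limsup (fun P => ((|h₁ P / h₂ P| : ℝ) : EReal)) (comap h₂ atTop) < ⊤) ∧
    (∀ (D E : Divisor V) (hD hE : GeomPoint π → ℝ),
      IsAmple π D → IsWeilHeight π D hD → IsWeilHeight π E hE →
        limsup (fun P => ((|hE P / hD P| : ℝ) : EReal)) (comap hD atTop) < ⊤) := by
  have key : ∀ (D E : Divisor V) (hD hE : GeomPoint π → ℝ),
      IsAmple π D → IsWeilHeight π D hD → IsWeilHeight π E hE →
        limsup (fun P => ((|hE P / hD P| : ℝ) : EReal)) (comap hD atTop) < ⊤ := by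
    intro D E hD hE hA hhD hhE
    obtain ⟨a, b, -, hb, h⟩ := exists_abs_le_of_isAmple hA hhD hhE
    exact limsup_abs_div_lt_top hb h
  refine ⟨fun D₁ D₂ h₁ h₂ hA₁ hA₂ hh₁ hh₂ => ?_, key⟩
  have habs := key D₂ D₁ h₂ h₁ hA₂ hh₂ hh₁
  refine ⟨?_, lt_of_le_of_lt (limsup_le_limsup ?_) habs, habs⟩
  · obtain ⟨a, b, ha, -, h⟩ := exists_abs_le_of_isAmple hA₁ hh₁ hh₂
    exact liminf_div_pos ha fun P => (le_abs_self _).trans (h P)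
  · exact Eventually.of_forall fun P => EReal.coe_le_coe_iff.2 (le_abs_self _)
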